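/- Let $\mathcal X$ be a measurable space with a $\sigma$-finite measure $\nu$, and let $0<\phi<1$, $s>0$. Consider i.i.d. observations $(X_i,Y_i)_{i=1}^n$ from the location-scale model $Y_i=\mu(X_i)+\sigma(X_i)\epsilon_i$, where $X_i$ has density $h$ with respect to $\nu$, $\epsilon_i$ is independent of $X_i$, and $\epsilon_i$ has the asymmetric normal density $$f(y)=\frac{2}{\sqrt{\pi}\,s}\,\frac{\sqrt{\phi(1-\phi)}}{\sqrt{\phi}+\sqrt{1-\phi}}\exp\Big[-\frac{\phi}{s^2}y^2I(y\ge 0)-\frac{1-\phi}{s^2}y^2I(y<0)\Big].$$ Let $\mu\in\mathcal U$, $\sigma\in\Sigma$, $h\in\mathcal H$, where $\mathcal U$ is a uniformly bounded class of measurable functions, $\Sigma$ is a non-empty class of measurable functions with $\overline\sigma^{-1}\le\sigma(x)\le\overline\sigma$ for all $\sigma \in \Sigma$ and $x\in\mathcal X$, for some constant $\overline\sigma>1$, and $\mathcal H$ is a class of probability densities. Suppose that there are $h_0\in\mathcal H$ and $C<\infty$ such that for every $h\in\mathcal H$, $h\le Ch_0$ holds $\nu$-almost everywhere. Write $\|g\|_{2,h}^2=\int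 g^2h\,d\nu$. For a class $\mathcal F$ that is totally bounded in $L_2(h_0)$, let the packing entropy $M_{h_0}(\varepsilon;\mathcal F)$ be the logarithm of the maximal cardinality of a finite subset of $\mathcal F$ whose distinct elements are at $L_2(h_0)$ distance greater than $\varepsilon$. Suppose that $\mathcal U$ and $\Sigma$ are totally bounded in $L_2(h_0)$, that $M_{h_0}(\varepsilon;\Sigma)=O(M_{h_0}(\varepsilon;\mathcal U))$ as $\varepsilon\to0^+$, and that $M_{h_0}(\cdot\,;\mathcal U)$ has a known order $M$, that is $M(\varepsilon)\asymp M_{h_0}(\varepsilon;\mathcal U)$ as $\varepsilon\to0^+$ (for instance $M=M_{h_0}(\cdot\,;\mathcal U)$), which is rich ($\liminf_{\varepsilon\to0^+}M(\alpha\varepsilon)/M(\varepsilon)>1$ for some $0<\alpha<1$) and regular ($M(c\varepsilon)\asymp M(\varepsilon)$ as $\varepsilon\to0^+$ for every $c>0$). Then $\mu(x)$ is the unique $\phi$-th expectile of the conditional distribution of $Y$ given $X=x$, that is, the unique $z$ with $\mathbb E[(z-Y)I(Y\le z)\mid X=x]=\phi\,\mathbb E[|z-Y|\mid X=x]$; and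 the minimax risk for estimating the expectile function $\mu$ satisfies $$\inf_{\hat\mu}\ \sup_{\mu\in\mathcal U,\ \sigma\in\Sigma,\ h\in\mathcal H}\mathbb E\|\mu-\hat\mu\|_{2,h}^2\asymp\varepsilon_n^2\qquad(n\to\infty),$$ where the infimum is over all (jointly measurable) estimators based on the $n$ observations, and $\varepsilon_n>0$ is determined by $M_{h_0}(\varepsilon_n;\mathcal U)=n\varepsilon_n^2$. This holds in each of the following senses: for every sequence $\varepsilon_n>0$ that satisfies this equation for all large $n$; for the crossing point $\varepsilon_n=\inf\{\varepsilon>0: M_{h_0}(\varepsilon;\mathcal U)\le n\varepsilon^2\}$, which always exists for $n \ge 1$ and equals the solution of the equation if there is one; and for every sequence of positive $\varepsilon_n\to0$ with $M(\varepsilon_n)\asymp n\varepsilon_n^2$, in particular with $M(\varepsilon_n)=n\varepsilon_n^2$. -/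

import Mathlib

open MeasureTheory Filter Topology Asymptotics
open scoped ENNReal

noncomputable section

namespace ExpectileMinimax

/-- Density of the asymmetric normal distribution with skewness `φ`, location `η` and scale `s`. -/
def asymNormalPDF (φ η s y : ℝ) : ℝ :=
  2 / (Real.sqrt Real.pi * s) *
    (Real.sqrt (φ * (1 - φ)) / (Real.sqrt φ + Real.sqrt (1 - φ))) *
    Real.exp (-(if η ≤ y then φ / s ^ 2 * (y - η) ^ 2 else (1 - φ) / s ^ 2 * (y - η) ^ 2))

/-- The asymmetric normal distribution with location `0`, as a measure on the real line. -/
def errorLaw (φ s : ℝ) : Measure ℝ :=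
  volume.withDensity fun y => ENNReal.ofReal (asymNormalPDF φ 0 s y)

/-- `z` is a `φ`-th expectile of the distribution `Q`. -/
def IsExpectile (φ : ℝ) (Q : Measure ℝ) (z : ℝ) : Prop :=
  Integrable (fun y : ℝ => y) Q ∧
    ∫ y in Set.Iic z, (z - y) ∂Q = φ * ∫ y, |z - y| ∂Q

section Model

variable {X : Type*} [MeasurableSpace X]

/-- `h` is a probability density with respect to `ν`. -/
structure IsDensity (ν : Measure X) (h : X → ℝ) : Prop where
  measurable : Measurable h
  nonneg : ∀ x, 0 ≤ h x
  lintegral_eq_one : ∫⁻ x, ENNReal.ofReal (h x) ∂ν = 1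

/-- The distribution of the covariate with density `h`. -/
def designLaw (ν : Measure X) (h : X → ℝ) : Measure X :=
  ν.withDensity fun x => ENNReal.ofReal (h x)

/-- Conditional distribution of the response `μ(x) + σ(x) e` given that the covariate is `x`. -/
def responseLaw (φ s : ℝ) (μ σ : X → ℝ) (x : X) : Measure ℝ :=
  (errorLaw φ s).map fun e => μ x + σ x * e

/-- Distribution of one observation `(x, μ(x) + σ(x) e)`, where the covariate `x` has density `h`
and is independent of the asymmetric normal error `e`. -/
def observationLaw (ν : Measure X) (φ s : ℝ) (μ σ h : X → ℝ) : Measure (X × ℝ) :=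
  ((designLaw ν h).prod (errorLaw φ s)).map fun p => (p.1, μ p.1 + σ p.1 * p.2)

/-- Distribution of `n` i.i.d. observations. -/
def sampleLaw (ν : Measure X) (φ s : ℝ) (μ σ h : X → ℝ) (n : ℕ) : Measure (Fin n → X × ℝ) :=
  Measure.pi fun _ => observationLaw ν φ s μ σ h

/-- The `L₂(h)` distance. -/
def l2Dist (ν : Measure X) (h f g : X → ℝ) : ℝ≥0∞ :=
  eLpNorm (fun x => f x - g x) 2 (designLaw ν h)

/-- Expected squared `L₂(h)` loss of the estimator `est`. -/
def risk (ν : Measure X) (φ s : ℝ) (μ σ h : X → ℝ) (n : ℕ)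
    (est : (Fin n → X × ℝ) → X → ℝ) : ℝ≥0∞ :=
  ∫⁻ d, (l2Dist ν h μ (est d)) ^ 2 ∂(sampleLaw ν φ s μ σ h n)

/-- The minimax risk with sample size `n`; the infimum is over all estimators `est` for which
`est d x` is jointly measurable in the data `d` and the point `x`. -/
def minimaxRisk (ν : Measure X) (φ s : ℝ) (U S H : Set (X → ℝ)) (n : ℕ) : ℝ≥0∞ :=
  ⨅ (est : (Fin n → X × ℝ) → X → ℝ) (_ : Measurable (Function.uncurry est)),
    ⨆ (μ ∈ U) (σ ∈ S) (h ∈ H), risk ν φ s μ σ h n est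

/-- Maximal cardinality of a finite subset of `F` whose distinct elements are at `L₂(h)` distance
greater than `ε`. -/
def packingNumber (ν : Measure X) (h : X → ℝ) (F : Set (X → ℝ)) (ε : ℝ) : ℕ∞ :=
  ⨆ (N : Finset (X → ℝ)) (_ : (N : Set (X → ℝ)) ⊆ F ∧
      (N : Set (X → ℝ)).Pairwise fun f g => ENNReal.ofReal ε < l2Dist ν h f g), (N.card : ℕ∞)

/-- Total boundedness of `F` in the `L₂(h)` distance. -/
def IsTotallyBounded (ν : Measure X) (h : X → ℝ) (F : Set (X → ℝ)) : Prop :=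
  ∀ ε : ℝ, 0 < ε → packingNumber ν h F ε ≠ ⊤

/-- Packing `ε`-entropy in the `L₂(h)` distance (used for totally bounded classes only). -/
def packingEntropy (ν : Measure X) (h : X → ℝ) (F : Set (X → ℝ)) (ε : ℝ) : ℝ :=
  Real.log ((packingNumber ν h F ε).toNat : ℝ)

end Model

/-- Richness of an entropy order; the lower limit is taken in the extended reals. -/
def IsRich (M : ℝ → ℝ) : Prop :=
  ∃ α : ℝ, 0 < α ∧ α < 1 ∧
    1 < liminf (fun ε : ℝ => ((M (α * ε) / M ε : ℝ) : EReal)) (𝓝[>] 0)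

/-- Order regularity of an entropy order. -/
def IsOrderRegular (M : ℝ → ℝ) : Prop :=
  ∀ c : ℝ, 0 < c → M =Θ[𝓝[>] 0] fun ε => M (c * ε)

/-- The point where the nonincreasing function `E` crosses `ε ↦ n ε²`. It is the solution of
`E ε = n ε²` if there is one. -/
def criticalRadius (E : ℝ → ℝ) (n : ℕ) : ℝ :=
  sInf {ε : ℝ | 0 < ε ∧ E ε ≤ n * ε ^ 2}

/-- `R n ≍ r n`. -/
def SameOrder (R : ℕ → ℝ≥0∞) (r : ℕ → ℝ) : Prop :=
  ∃ c C : ℝ, 0 < c ∧ 0 < C ∧ ∀ᶠ n in atTop,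
    ENNReal.ofReal (c * r n) ≤ R n ∧ R n ≤ ENNReal.ofReal (C * r n)

end ExpectileMinimax

end

open ExpectileMinimax

/-!
Upper bound: aggregate a maximal `ε`-packing of the regression class with exponential weights built
from the empirical expectile loss `L`. The asymmetric normal score is centred at the true location
and sub-Gaussian, and the loss is strongly convex, so for small `β` the moment `E exp (β * (L f -
L g))` decays exponentially in `n` times the squared distance from `g` to the truth, up to that of
`f`. Gibbs' variational principle turns this into a risk of order the log-cardinality of the packing
over `n` plus `ε ^ 2`, whatever the scale function and the design density.

Lower bound: fix one scale function and the dominating design `h₀`. The sample laws of regression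
functions within `ε` of each other have likelihood ratios with second moment at most
`exp (K * n * ε ^ 2)`. Covering a fine `δ`-packing by `ε`-balls, no estimator can separate its
elements as soon as the entropy at `δ` exceeds the entropy at `ε` by a constant plus a multiple of
`n * ε ^ 2`; richness provides such a `δ` that is a constant multiple of `ε`.
-/

namespace ExpectileMinimax

/-! ### The expectile loss and its score -/

/-- The weight `|φ - 1{u < 0}|` that the expectile loss puts on a residual `u`. -/
noncomputable def expectileWeight (φ u : ℝ) : ℝ := if 0 ≤ u then φ else 1 - φ

/-- The asymmetric squared loss, whose mean is minimised at the `φ`-th expectile. -/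
noncomputable def expectileLoss (φ u : ℝ) : ℝ := expectileWeight φ u * u ^ 2

/-- Half the derivative of the asymmetric squared loss. -/
noncomputable def expectileScore (φ u : ℝ) : ℝ := expectileWeight φ u * u

section Loss

variable {φ c C r u v : ℝ}

lemma measurable_expectileWeight (φ : ℝ) : Measurable (expectileWeight φ) :=
  Measurable.ite measurableSet_Ici measurable_const measurable_const

@[fun_prop]
lemma measurable_expectileLoss (φ : ℝ) : Measurable (expectileLoss φ) :=
  (measurable_expectileWeight φ).mul (measurable_id.pow_const 2)

@[fun_prop]
lemma measurable_expectileScore (φ : ℝ) : Measurable (expectileScore φ) :=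
  (measurable_expectileWeight φ).mul measurable_id

lemma le_expectileWeight (h₀ : c ≤ φ) (h₁ : c ≤ 1 - φ) (u : ℝ) : c ≤ expectileWeight φ u := by
  unfold expectileWeight
  split_ifs <;> assumption

lemma expectileWeight_le (h₀ : φ ≤ C) (h₁ : 1 - φ ≤ C) (u : ℝ) : expectileWeight φ u ≤ C := by
  unfold expectileWeight
  split_ifs <;> assumption

lemma expectileWeight_eq_or_mul_nonpos (φ u v : ℝ) :
    expectileWeight φ u = expectileWeight φ v ∨ u * v ≤ 0 := by
  unfold expectileWeight
  rcases le_or_gt 0 u with hu | hu <;> rcases le_or_gt 0 v with hv | hv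
  · simp [hu, hv]
  · exact .inr (mul_nonpos_of_nonneg_of_nonpos hu hv.le)
  · exact .inr (mul_nonpos_of_nonpos_of_nonneg hu.le hv)
  · simp [hu.not_ge, hv.not_ge]

lemma expectileScore_mul (hr : 0 ≤ r) (u : ℝ) :
    expectileScore φ (r * u) = r * expectileScore φ u := by
  rcases hr.eq_or_lt with rfl | hr
  · simp [expectileScore]
  · simp only [expectileScore, expectileWeight, mul_nonneg_iff_of_pos_left hr]
    ring

lemma abs_expectileScore_le (h₀ : 0 ≤ φ) (h₁ : φ ≤ 1) (u : ℝ) : |expectileScore φ u| ≤ |u| := by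
  rw [expectileScore, abs_mul, abs_of_nonneg (le_expectileWeight h₀ (sub_nonneg.2 h₁) u)]
  exact mul_le_of_le_one_left (abs_nonneg u) (expectileWeight_le h₁ (by linarith) u)

lemma mul_sub_le_expectileScore_sub (h₀ : c ≤ φ) (h₁ : c ≤ 1 - φ) (huv : u ≤ v) :
    c * (v - u) ≤ expectileScore φ v - expectileScore φ u := by
  unfold expectileScore expectileWeight
  split_ifs <;> nlinarith

lemma mul_sq_le_expectileLoss (h₀ : c ≤ φ) (h₁ : c ≤ 1 - φ) (u : ℝ) :
    c * u ^ 2 ≤ expectileLoss φ u :=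
  mul_le_mul_of_nonneg_right (le_expectileWeight h₀ h₁ u) (sq_nonneg u)

lemma expectileLoss_sub_eq (φ u a : ℝ) :
    expectileLoss φ (u - a) = expectileLoss φ u - 2 * a * expectileScore φ u +
      (expectileWeight φ (u - a) * (u - a) ^ 2 + expectileWeight φ u * (a ^ 2 - (u - a) ^ 2)) := by
  unfold expectileLoss expectileScore
  ring

lemma sq_sub_le_sq_of_mul_nonpos {u a : ℝ} (h : (u - a) * u ≤ 0) : (u - a) ^ 2 ≤ a ^ 2 := by
  nlinarith [sq_nonneg u]

-- If `u` and `u - a` have the same sign, the remainder in `expectileLoss_sub_eq` is a single weight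
-- times `a ^ 2`; otherwise it is a combination of two weights whose coefficients
-- `(u - a) ^ 2` and `a ^ 2 - (u - a) ^ 2` are nonnegative and sum to `a ^ 2`.
lemma le_expectileLoss_sub (h₀ : c ≤ φ) (h₁ : c ≤ 1 - φ) (u a : ℝ) :
    expectileLoss φ u - 2 * a * expectileScore φ u + c * a ^ 2 ≤ expectileLoss φ (u - a) := by
  rw [expectileLoss_sub_eq]
  have hw := le_expectileWeight h₀ h₁
  rcases expectileWeight_eq_or_mul_nonpos φ (u - a) u with h | h
  · nlinarith [mul_le_mul_of_nonneg_right (hw u) (sq_nonneg a)]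
  · nlinarith [mul_le_mul_of_nonneg_right (hw (u - a)) (sq_nonneg (u - a)),
      mul_le_mul_of_nonneg_right (hw u) (sub_nonneg.2 (sq_sub_le_sq_of_mul_nonpos h))]

lemma expectileLoss_sub_le (h₀ : φ ≤ C) (h₁ : 1 - φ ≤ C) (u a : ℝ) :
    expectileLoss φ (u - a) ≤ expectileLoss φ u - 2 * a * expectileScore φ u + C * a ^ 2 := by
  rw [expectileLoss_sub_eq]
  have hw := expectileWeight_le h₀ h₁
  rcases expectileWeight_eq_or_mul_nonpos φ (u - a) u with h | h
  · nlinarith [mul_le_mul_of_nonneg_right (hw u) (sq_nonneg a)]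
  · nlinarith [mul_le_mul_of_nonneg_right (hw (u - a)) (sq_nonneg (u - a)),
      mul_le_mul_of_nonneg_right (hw u) (sub_nonneg.2 (sq_sub_le_sq_of_mul_nonpos h))]

lemma abs_expectileLoss_sub_sub_le (φ u a : ℝ) :
    |expectileLoss φ (u - a) - (expectileLoss φ u - 2 * a * expectileScore φ u)| ≤
      max |φ| |1 - φ| * a ^ 2 := by
  have hlo := le_expectileLoss_sub (c := -max |φ| |1 - φ|)
    (neg_le.1 ((neg_le_abs φ).trans (le_max_left _ _)))
    (neg_le.1 ((neg_le_abs (1 - φ)).trans (le_max_right _ _))) u a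
  have hhi := expectileLoss_sub_le ((le_abs_self φ).trans (le_max_left |φ| |1 - φ|))
    ((le_abs_self (1 - φ)).trans (le_max_right |φ| |1 - φ|)) u a
  rw [abs_le]
  constructor <;> linarith

lemma hasDerivAt_expectileLoss (φ u : ℝ) :
    HasDerivAt (expectileLoss φ) (2 * expectileScore φ u) u := by
  rw [hasDerivAt_iff_isLittleO_nhds_zero]
  refine IsBigO.trans_isLittleO (g := fun a : ℝ => a ^ 2) ?_
    (by simpa using isLittleO_pow_pow (𝕜 := ℝ) (m := 1) (n := 2) one_lt_two)
  refine IsBigO.of_bound (max |φ| |1 - φ|) (Eventually.of_forall fun a => ?_)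
  have h := abs_expectileLoss_sub_sub_le φ u (-a)
  rw [sub_neg_eq_add, neg_sq] at h
  rw [Real.norm_eq_abs, Real.norm_of_nonneg (sq_nonneg a), smul_eq_mul]
  convert h using 2
  ring

end Loss

/-! ### The asymmetric normal distribution -/

/-- The normalising constant of the asymmetric normal density. -/
noncomputable def asymNormalConst (φ s : ℝ) : ℝ :=
  2 / (√Real.pi * s) * (√(φ * (1 - φ)) / (√φ + √(1 - φ)))

section ErrorLaw

variable {φ s b c : ℝ}

lemma asymNormalConst_pos (hφ₀ : 0 < φ) (hφ₁ : φ < 1) (hs : 0 < s) : 0 < asymNormalConst φ s := by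
  have : 0 < 1 - φ := sub_pos.2 hφ₁
  unfold asymNormalConst
  positivity

lemma asymNormalPDF_zero (φ s y : ℝ) :
    asymNormalPDF φ 0 s y = asymNormalConst φ s * Real.exp (-(expectileLoss φ y / s ^ 2)) := by
  unfold asymNormalPDF asymNormalConst expectileLoss expectileWeight
  congr 3
  split_ifs <;> ring

@[fun_prop]
lemma measurable_asymNormalPDF (φ s : ℝ) : Measurable (asymNormalPDF φ 0 s) := by
  simp only [funext (asymNormalPDF_zero φ s)]
  fun_prop

lemma asymNormalPDF_nonneg (hs : 0 ≤ s) (y : ℝ) : 0 ≤ asymNormalPDF φ 0 s y := by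
  unfold asymNormalPDF
  positivity

lemma asymNormalPDF_le (hs : 0 ≤ s) (hc₀ : c ≤ φ) (hc₁ : c ≤ 1 - φ) (y : ℝ) :
    asymNormalPDF φ 0 s y ≤ asymNormalConst φ s * Real.exp (-(c / s ^ 2) * y ^ 2) := by
  have hconst : 0 ≤ asymNormalConst φ s := by unfold asymNormalConst; positivity
  have hloss := div_le_div_of_nonneg_right (mul_sq_le_expectileLoss hc₀ hc₁ y) (sq_nonneg s)
  rw [asymNormalPDF_zero]
  refine mul_le_mul_of_nonneg_left (Real.exp_le_exp.2 ?_) hconst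
  calc -(expectileLoss φ y / s ^ 2) ≤ -(c * y ^ 2 / s ^ 2) := neg_le_neg hloss
    _ = -(c / s ^ 2) * y ^ 2 := by ring

lemma integral_errorLaw (hs : 0 ≤ s) (g : ℝ → ℝ) :
    ∫ y, g y ∂errorLaw φ s = ∫ y, asymNormalPDF φ 0 s y * g y := by
  rw [errorLaw, integral_withDensity_eq_integral_toReal_smul
    (measurable_asymNormalPDF φ s).ennreal_ofReal (by simp)]
  simp [ENNReal.toReal_ofReal (asymNormalPDF_nonneg hs _)]

lemma integrable_errorLaw_iff (hs : 0 ≤ s) (g : ℝ → ℝ) :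
    Integrable g (errorLaw φ s) ↔ Integrable fun y => asymNormalPDF φ 0 s y * g y := by
  rw [errorLaw, integrable_withDensity_iff_integrable_smul'
    (measurable_asymNormalPDF φ s).ennreal_ofReal (by simp)]
  simp [ENNReal.toReal_ofReal (asymNormalPDF_nonneg hs _)]

lemma integrable_exp_mul_sq_errorLaw (hs : 0 < s) (h₀ : b * s ^ 2 < φ) (h₁ : b * s ^ 2 < 1 - φ) :
    Integrable (fun y => Real.exp (b * y ^ 2)) (errorLaw φ s) := by
  set c := min φ (1 - φ)
  have hbc : 0 < c / s ^ 2 - b := sub_pos.2 ((lt_div_iff₀ (by positivity)).2 (lt_min h₀ h₁))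
  rw [integrable_errorLaw_iff hs.le]
  refine ((integrable_exp_neg_mul_sq hbc).const_mul (asymNormalConst φ s)).mono' (by fun_prop)
    (Eventually.of_forall fun y => ?_)
  rw [Real.norm_of_nonneg (mul_nonneg (asymNormalPDF_nonneg hs.le y) (Real.exp_nonneg _))]
  calc asymNormalPDF φ 0 s y * Real.exp (b * y ^ 2)
      ≤ asymNormalConst φ s * Real.exp (-(c / s ^ 2) * y ^ 2) * Real.exp (b * y ^ 2) :=
        mul_le_mul_of_nonneg_right
          (asymNormalPDF_le hs.le (min_le_left _ _) (min_le_right _ _) y) (Real.exp_nonneg _)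
    _ = asymNormalConst φ s * Real.exp (-(c / s ^ 2 - b) * y ^ 2) := by
        rw [mul_assoc, ← Real.exp_add]
        ring_nf

lemma integrable_asymNormalPDF (hφ₀ : 0 < φ) (hφ₁ : φ < 1) (hs : 0 < s) :
    Integrable (asymNormalPDF φ 0 s) := by
  have h := integrable_exp_mul_sq_errorLaw (φ := φ) (b := 0) hs (by simpa) (by simpa)
  simpa [integrable_errorLaw_iff hs.le] using h

lemma integral_exp_neg_expectileLoss (hφ₀ : 0 < φ) (hφ₁ : φ < 1) (hs : 0 < s) :
    ∫ y, Real.exp (-(expectileLoss φ y / s ^ 2)) =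
      √(Real.pi / (φ / s ^ 2)) / 2 + √(Real.pi / ((1 - φ) / s ^ 2)) / 2 := by
  set f : ℝ → ℝ := fun y => Real.exp (-(expectileLoss φ y / s ^ 2))
  have hpos : ∀ y ∈ Set.Ioi (0 : ℝ), f y = Real.exp (-(φ / s ^ 2) * y ^ 2) := fun y hy => by
    simp only [f, expectileLoss, expectileWeight, if_pos (Set.mem_Ioi.1 hy).le]
    ring_nf
  have hneg : ∀ y ∈ Set.Ioi (0 : ℝ), f (-y) = Real.exp (-((1 - φ) / s ^ 2) * y ^ 2) :=
    fun y hy => by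
      simp only [f, expectileLoss, expectileWeight,
        if_neg (not_le.2 (neg_lt_zero.2 (Set.mem_Ioi.1 hy)))]
      ring_nf
  have hf : Integrable f := by
    have h := (integrable_asymNormalPDF hφ₀ hφ₁ hs).const_mul (asymNormalConst φ s)⁻¹
    simpa only [asymNormalPDF_zero,
      inv_mul_cancel_left₀ (asymNormalConst_pos hφ₀ hφ₁ hs).ne'] using h
  have hreflect := integral_comp_neg_Ioi (0 : ℝ) f
  rw [neg_zero] at hreflect
  rw [← integral_add_compl measurableSet_Ioi hf (s := Set.Ioi (0 : ℝ)), Set.compl_Ioi, ← hreflect,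
    setIntegral_congr_fun measurableSet_Ioi hpos, setIntegral_congr_fun measurableSet_Ioi hneg,
    integral_gaussian_Ioi, integral_gaussian_Ioi]

lemma integral_asymNormalPDF (hφ₀ : 0 < φ) (hφ₁ : φ < 1) (hs : 0 < s) :
    ∫ y, asymNormalPDF φ 0 s y = 1 := by
  have hφ₁' : 0 < 1 - φ := sub_pos.2 hφ₁
  simp_rw [asymNormalPDF_zero]
  rw [integral_const_mul, integral_exp_neg_expectileLoss hφ₀ hφ₁ hs, asymNormalConst,
    div_div_eq_mul_div, div_div_eq_mul_div, Real.sqrt_div (by positivity),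
    Real.sqrt_div (by positivity), Real.sqrt_mul Real.pi_pos.le, Real.sqrt_sq hs.le,
    Real.sqrt_mul hφ₀.le]
  have : 0 < √φ := Real.sqrt_pos.2 hφ₀
  have : 0 < √(1 - φ) := Real.sqrt_pos.2 hφ₁'
  have : 0 < √Real.pi := Real.sqrt_pos.2 Real.pi_pos
  field_simp
  ring

lemma isProbabilityMeasure_errorLaw (hφ₀ : 0 < φ) (hφ₁ : φ < 1) (hs : 0 < s) :
    IsProbabilityMeasure (errorLaw φ s) := by
  refine ⟨?_⟩
  rw [errorLaw, withDensity_apply _ MeasurableSet.univ, Measure.restrict_univ,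
    ← ofReal_integral_eq_lintegral_ofReal (integrable_asymNormalPDF hφ₀ hφ₁ hs)
    (Eventually.of_forall (asymNormalPDF_nonneg hs.le)), integral_asymNormalPDF hφ₀ hφ₁ hs,
    ENNReal.ofReal_one]

lemma integrable_id_errorLaw (hφ₀ : 0 < φ) (hφ₁ : φ < 1) (hs : 0 < s) :
    Integrable id (errorLaw φ s) := by
  set c := min φ (1 - φ)
  have : 0 < c := lt_min hφ₀ (sub_pos.2 hφ₁)
  rw [integrable_errorLaw_iff hs.le]
  refine ((integrable_mul_exp_neg_mul_sq (b := c / s ^ 2) (by positivity)).norm.const_mul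
    (asymNormalConst φ s)).mono' (by fun_prop) (Eventually.of_forall fun y => ?_)
  have hpdf := asymNormalPDF_le (c := c) hs.le (min_le_left _ _) (min_le_right _ _) y
  rw [norm_mul, norm_mul, Real.norm_of_nonneg (asymNormalPDF_nonneg hs.le y),
    Real.norm_of_nonneg (Real.exp_nonneg _)]
  calc asymNormalPDF φ 0 s y * ‖y‖
      ≤ asymNormalConst φ s * Real.exp (-(c / s ^ 2) * y ^ 2) * ‖y‖ :=
        mul_le_mul_of_nonneg_right hpdf (norm_nonneg y)
    _ = asymNormalConst φ s * (‖y‖ * Real.exp (-(c / s ^ 2) * y ^ 2)) := by ring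

lemma integrable_expectileScore_errorLaw (hφ₀ : 0 < φ) (hφ₁ : φ < 1) (hs : 0 < s) :
    Integrable (expectileScore φ) (errorLaw φ s) :=
  (integrable_id_errorLaw hφ₀ hφ₁ hs).mono (measurable_expectileScore φ).aestronglyMeasurable
    (Eventually.of_forall fun y => abs_expectileScore_le hφ₀.le hφ₁.le y)

lemma hasDerivAt_asymNormalPDF (φ s y : ℝ) :
    HasDerivAt (asymNormalPDF φ 0 s)
      (-(2 / s ^ 2) * (asymNormalPDF φ 0 s y * expectileScore φ y)) y := by
  rw [funext (asymNormalPDF_zero φ s)]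
  refine ((((hasDerivAt_expectileLoss φ y).div_const (s ^ 2)).neg.exp).const_mul
    (asymNormalConst φ s)).congr_deriv ?_
  simp only [Pi.neg_apply]
  ring

lemma tendsto_asymNormalPDF (hφ₀ : 0 < φ) (hφ₁ : φ < 1) (hs : 0 < s) {l : Filter ℝ}
    (hl : Tendsto (fun y : ℝ => y ^ 2) l atTop) : Tendsto (asymNormalPDF φ 0 s) l (𝓝 0) := by
  have hb : 0 < min φ (1 - φ) / s ^ 2 := div_pos (lt_min hφ₀ (sub_pos.2 hφ₁)) (by positivity)
  refine squeeze_zero (asymNormalPDF_nonneg hs.le)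
    (asymNormalPDF_le hs.le (min_le_left _ _) (min_le_right _ _)) ?_
  rw [← mul_zero (asymNormalConst φ s)]
  exact ((Real.tendsto_exp_atBot.comp
    ((tendsto_const_mul_atBot_of_neg (neg_lt_zero.2 hb)).2 hl))).const_mul _

-- The score is, up to a constant, the derivative of the density divided by the density.
lemma integral_expectileScore_errorLaw (hφ₀ : 0 < φ) (hφ₁ : φ < 1) (hs : 0 < s) :
    ∫ y, expectileScore φ y ∂errorLaw φ s = 0 := by
  have hint := (integrable_errorLaw_iff hs.le _).1 (integrable_expectileScore_errorLaw hφ₀ hφ₁ hs)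
  have hbot : Tendsto (fun y : ℝ => y ^ 2) atBot atTop :=
    ((tendsto_pow_atTop (α := ℝ) two_ne_zero).comp tendsto_abs_atBot_atTop).congr sq_abs
  have h := integral_of_hasDerivAt_of_tendsto (hasDerivAt_asymNormalPDF φ s) (hint.const_mul _)
    (tendsto_asymNormalPDF hφ₀ hφ₁ hs hbot)
    (tendsto_asymNormalPDF hφ₀ hφ₁ hs (tendsto_pow_atTop two_ne_zero))
  rw [integral_const_mul, sub_zero] at h
  rw [integral_errorLaw hs.le]
  exact (mul_eq_zero.1 h).resolve_left (by simp [hs.ne'])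

end ErrorLaw

/-! ### Sub-Gaussian moment generating functions -/

section SubGaussian

open ProbabilityTheory
open scoped NNReal

lemma exp_le_add_exp_sq (x : ℝ) : Real.exp x ≤ x + Real.exp (x ^ 2) := by
  have hsq := Real.add_one_le_exp (x ^ 2)
  rcases le_or_gt |x| 1 with hx | hx
  · linarith [abs_le.1 (Real.abs_exp_sub_one_sub_id_le hx)]
  rcases lt_abs.1 hx with hx | hx
  · linarith [Real.exp_le_exp.2 (show x ≤ x ^ 2 by nlinarith)]
  · nlinarith [Real.exp_le_one_iff.2 (show x ≤ 0 by linarith)]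

variable {Ω : Type*} [MeasurableSpace Ω] {P : Measure Ω} {Z : Ω → ℝ} {b t : ℝ}

lemma lintegral_exp_le_of_hasSubgaussianMGF {κ : ℝ≥0} (h : HasSubgaussianMGF Z κ P) (t : ℝ) :
    ∫⁻ ω, ENNReal.ofReal (Real.exp (t * Z ω)) ∂P ≤ ENNReal.ofReal (Real.exp (κ * t ^ 2 / 2)) := by
  rw [← ofReal_integral_eq_lintegral_ofReal (h.integrable_exp_mul t)
    (Eventually.of_forall fun ω => Real.exp_nonneg _)]
  exact ENNReal.ofReal_le_ofReal (h.mgf_le t)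

variable [IsProbabilityMeasure P]

lemma mgf_le_of_sq_le (hZ : Integrable Z P) (hZ₀ : ∫ ω, Z ω ∂P = 0) (hb : 0 < b)
    (hexp : Integrable (fun ω => Real.exp (b * Z ω ^ 2)) P) (ht : t ^ 2 ≤ b) :
    mgf Z P t ≤ Real.exp (t ^ 2 / b * (∫ ω, Real.exp (b * Z ω ^ 2) ∂P - 1)) := by
  set θ := t ^ 2 / b with hθ
  have hθ₀ : 0 ≤ θ := by positivity
  have hθ₁ : θ ≤ 1 := (div_le_one hb).2 ht
  -- convexity of the exponential between `0` and `b * Z ω ^ 2`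
  have hconv : ∀ ω, Real.exp ((t * Z ω) ^ 2) ≤ (1 - θ) + θ * Real.exp (b * Z ω ^ 2) := fun ω => by
    have h := convexOn_exp.2 (Set.mem_univ 0) (Set.mem_univ (b * Z ω ^ 2)) (sub_nonneg.2 hθ₁) hθ₀
      (sub_add_cancel 1 θ)
    have hexponent : (t * Z ω) ^ 2 = θ * (b * Z ω ^ 2) := by rw [hθ]; field_simp
    simpa [hexponent] using h
  have hbound : Integrable (fun ω => (1 - θ) + θ * Real.exp (b * Z ω ^ 2)) P :=
    (integrable_const _).add (hexp.const_mul θ)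
  calc mgf Z P t ≤ ∫ ω, (t * Z ω + ((1 - θ) + θ * Real.exp (b * Z ω ^ 2))) ∂P :=
        integral_mono_of_nonneg (Eventually.of_forall fun ω => Real.exp_nonneg _)
          ((hZ.const_mul t).add hbound)
          (Eventually.of_forall fun ω =>
            (exp_le_add_exp_sq _).trans (add_le_add_right (hconv ω) _))
    _ = θ * (∫ ω, Real.exp (b * Z ω ^ 2) ∂P - 1) + 1 := by
        rw [integral_add (hZ.const_mul t) hbound,
          integral_add (integrable_const _) (hexp.const_mul θ), integral_const_mul,
          integral_const_mul, hZ₀, integral_const, probReal_univ, one_smul]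
        ring
    _ ≤ Real.exp (θ * (∫ ω, Real.exp (b * Z ω ^ 2) ∂P - 1)) := Real.add_one_le_exp _

lemma exp_mul_le_exp_mul_exp_mul_sq (hb : 0 < b) (t x : ℝ) :
    Real.exp (t * x) ≤ Real.exp (t ^ 2 / (4 * b)) * Real.exp (b * x ^ 2) := by
  rw [← Real.exp_add, Real.exp_le_exp]
  have hsq : 0 ≤ b * (x - t / (2 * b)) ^ 2 := by positivity
  have hexpand : b * (x - t / (2 * b)) ^ 2 = t ^ 2 / (4 * b) + b * x ^ 2 - t * x := by
    field_simp
    ring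
  linarith

lemma exists_hasSubgaussianMGF (hZ : Integrable Z P) (hZ₀ : ∫ ω, Z ω ∂P = 0) (hb : 0 < b)
    (hexp : Integrable (fun ω => Real.exp (b * Z ω ^ 2)) P) :
    ∃ κ : ℝ≥0, HasSubgaussianMGF Z κ P := by
  set A := ∫ ω, Real.exp (b * Z ω ^ 2) ∂P
  have hA : 0 ≤ A := integral_nonneg fun ω => Real.exp_nonneg _
  have hle := exp_mul_le_exp_mul_exp_mul_sq hb
  have hκ : 0 ≤ 2 * (1 / (4 * b) + A / b) := by positivity
  refine ⟨Real.toNNReal (2 * (1 / (4 * b) + A / b)), fun t => ?_, fun t => ?_⟩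
  · refine (hexp.const_mul (Real.exp (t ^ 2 / (4 * b)))).mono'
      (Real.continuous_exp.comp_aestronglyMeasurable (hZ.aestronglyMeasurable.const_mul t))
      (Eventually.of_forall fun ω => ?_)
    rw [Real.norm_of_nonneg (Real.exp_nonneg _)]
    exact hle t (Z ω)
  · have hexponent : 2 * (1 / (4 * b) + A / b) * t ^ 2 / 2 = t ^ 2 / (4 * b) + t ^ 2 / b * A := by
      ring
    rw [Real.coe_toNNReal _ hκ, hexponent]
    rcases le_total (t ^ 2) b with ht | ht
    · refine (mgf_le_of_sq_le hZ hZ₀ hb hexp ht).trans (Real.exp_le_exp.2 ?_)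
      have : 0 ≤ t ^ 2 / (4 * b) := by positivity
      have : 0 ≤ t ^ 2 / b := by positivity
      linarith
    · calc mgf Z P t ≤ ∫ ω, Real.exp (t ^ 2 / (4 * b)) * Real.exp (b * Z ω ^ 2) ∂P :=
            integral_mono_of_nonneg (Eventually.of_forall fun ω => Real.exp_nonneg _)
              (hexp.const_mul _) (Eventually.of_forall fun ω => hle t (Z ω))
        _ = Real.exp (t ^ 2 / (4 * b)) * A := integral_const_mul _ _
        _ ≤ Real.exp (t ^ 2 / (4 * b)) * Real.exp (t ^ 2 / b * A) := by
            have hbA : A ≤ t ^ 2 / b * A := le_mul_of_one_le_left hA ((one_le_div hb).2 ht)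
            exact mul_le_mul_of_nonneg_left (by linarith [Real.add_one_le_exp (t ^ 2 / b * A)])
              (Real.exp_nonneg _)
        _ = Real.exp (t ^ 2 / (4 * b) + t ^ 2 / b * A) := (Real.exp_add _ _).symm

end SubGaussian

lemma exists_hasSubgaussianMGF_expectileScore {φ s : ℝ} (hφ₀ : 0 < φ) (hφ₁ : φ < 1) (hs : 0 < s) :
    ∃ κ, ProbabilityTheory.HasSubgaussianMGF (expectileScore φ) κ (errorLaw φ s) := by
  have := isProbabilityMeasure_errorLaw hφ₀ hφ₁ hs
  have hc : 0 < min φ (1 - φ) := lt_min hφ₀ (sub_pos.2 hφ₁)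
  set b := min φ (1 - φ) / 2 / s ^ 2 with hb
  have hbs : b * s ^ 2 < min φ (1 - φ) := by
    rw [hb, div_mul_cancel₀ _ (by positivity)]
    exact half_lt_self hc
  refine exists_hasSubgaussianMGF (integrable_expectileScore_errorLaw hφ₀ hφ₁ hs)
    (integral_expectileScore_errorLaw hφ₀ hφ₁ hs) (b := b) (by positivity) ?_
  refine (integrable_exp_mul_sq_errorLaw hs (hbs.trans_le (min_le_left _ _))
    (hbs.trans_le (min_le_right _ _))).mono' (by fun_prop) (Eventually.of_forall fun y => ?_)
  rw [Real.norm_of_nonneg (Real.exp_nonneg _), Real.exp_le_exp]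
  exact mul_le_mul_of_nonneg_left (sq_le_sq.2 (abs_expectileScore_le hφ₀.le hφ₁.le y))
    (by positivity)

/-! ### Expectiles -/

section Expectile

variable {φ z w : ℝ} {Q : Measure ℝ}

lemma isExpectile_iff_integral_expectileScore [IsFiniteMeasure Q] :
    IsExpectile φ Q z ↔ Integrable id Q ∧ ∫ y, expectileScore φ (y - z) ∂Q = 0 := by
  refine and_congr_right fun hQ => ?_
  have hint : Integrable (fun y => z - y) Q := (integrable_const z).sub hQ
  have hscore : ∀ y, expectileScore φ (y - z) =
      -((Set.Iic z).indicator (fun y => z - y) y - φ * |z - y|) := fun y => by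
    rcases lt_trichotomy y z with h | rfl | h
    · simp only [expectileScore, expectileWeight, Set.indicator_of_mem (Set.mem_Iic.2 h.le),
        if_neg (not_le.2 (sub_neg.2 h)), abs_of_pos (sub_pos.2 h)]
      ring
    · simp [expectileScore]
    · simp only [expectileScore, expectileWeight,
        Set.indicator_of_notMem (Set.notMem_Iic.2 h), if_pos (sub_nonneg.2 h.le),
        abs_of_neg (sub_neg.2 h)]
      ring
  simp_rw [hscore]
  rw [integral_neg, integral_sub (hint.indicator measurableSet_Iic) (hint.abs.const_mul φ),
    integral_indicator measurableSet_Iic, integral_const_mul, neg_eq_zero, sub_eq_zero]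

lemma integrable_expectileScore_sub [IsFiniteMeasure Q] (hφ₀ : 0 ≤ φ) (hφ₁ : φ ≤ 1)
    (hQ : Integrable id Q) (z : ℝ) : Integrable (fun y => expectileScore φ (y - z)) Q :=
  (hQ.sub (integrable_const z)).mono
    ((measurable_expectileScore φ).comp (measurable_sub_const z)).aestronglyMeasurable
    (Eventually.of_forall fun y => abs_expectileScore_le hφ₀ hφ₁ (y - z))

lemma IsExpectile.le [IsProbabilityMeasure Q] (hφ₀ : 0 < φ) (hφ₁ : φ < 1)
    (hz : IsExpectile φ Q z) (hw : IsExpectile φ Q w) : z ≤ w := by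
  rw [isExpectile_iff_integral_expectileScore] at hz hw
  by_contra! hwz
  have hc : 0 < min φ (1 - φ) := lt_min hφ₀ (sub_pos.2 hφ₁)
  have hscore := integrable_expectileScore_sub hφ₀.le hφ₁.le hz.1
  have hgap : ∀ y, min φ (1 - φ) * (z - w) ≤ expectileScore φ (y - w) - expectileScore φ (y - z) :=
    fun y => by
      simpa using mul_sub_le_expectileScore_sub (min_le_left φ (1 - φ)) (min_le_right φ (1 - φ))
        (show y - z ≤ y - w by linarith)
  have h := integral_mono (μ := Q) (integrable_const _) ((hscore w).sub (hscore z)) hgap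
  simp only [Pi.sub_apply, integral_sub (hscore w) (hscore z), hz.2, hw.2, integral_const,
    probReal_univ, one_smul, sub_zero] at h
  linarith [mul_pos hc (sub_pos.2 hwz)]

lemma IsExpectile.eq [IsProbabilityMeasure Q] (hφ₀ : 0 < φ) (hφ₁ : φ < 1)
    (hz : IsExpectile φ Q z) (hw : IsExpectile φ Q w) : z = w :=
  (hz.le hφ₀ hφ₁ hw).antisymm (hw.le hφ₀ hφ₁ hz)

variable {X : Type*} {s : ℝ} {σ : X → ℝ} {x : X}

lemma isExpectile_responseLaw (hφ₀ : 0 < φ) (hφ₁ : φ < 1) (hs : 0 < s) (μ : X → ℝ)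
    (hσ : 0 ≤ σ x) : IsExpectile φ (responseLaw φ s μ σ x) (μ x) := by
  have := isProbabilityMeasure_errorLaw hφ₀ hφ₁ hs
  have hmeas : Measurable fun e : ℝ => μ x + σ x * e := by fun_prop
  have hscore : Measurable fun y => expectileScore φ (y - μ x) := by fun_prop
  have : IsFiniteMeasure (responseLaw φ s μ σ x) := by unfold responseLaw; infer_instance
  rw [isExpectile_iff_integral_expectileScore, responseLaw,
    integrable_map_measure (by fun_prop) hmeas.aemeasurable,
    integral_map hmeas.aemeasurable hscore.aestronglyMeasurable]
  refine ⟨(integrable_const _).add ((integrable_id_errorLaw hφ₀ hφ₁ hs).const_mul _), ?_⟩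
  simp_rw [add_sub_cancel_left, expectileScore_mul hσ]
  rw [integral_const_mul, integral_expectileScore_errorLaw hφ₀ hφ₁ hs, mul_zero]

lemma isExpectile_responseLaw_iff (hφ₀ : 0 < φ) (hφ₁ : φ < 1) (hs : 0 < s) (μ : X → ℝ)
    (hσ : 0 ≤ σ x) : IsExpectile φ (responseLaw φ s μ σ x) z ↔ z = μ x := by
  have := isProbabilityMeasure_errorLaw hφ₀ hφ₁ hs
  have : IsProbabilityMeasure (responseLaw φ s μ σ x) :=
    Measure.isProbabilityMeasure_map (by fun_prop)
  have hμ := isExpectile_responseLaw hφ₀ hφ₁ hs μ hσ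
  exact ⟨fun h => h.eq hφ₀ hφ₁ hμ, fun h => h ▸ hμ⟩

end Expectile

/-! ### Packings -/

section Packing

variable {X : Type*} [MeasurableSpace X] {ν : Measure X} {h : X → ℝ} {F : Set (X → ℝ)} {ε : ℝ}
  {N : Finset (X → ℝ)}

lemma l2Dist_self (f : X → ℝ) : l2Dist ν h f f = 0 := by simp [l2Dist]

lemma l2Dist_comm (f g : X → ℝ) : l2Dist ν h f g = l2Dist ν h g f := eLpNorm_sub_comm f g 2 _

lemma l2Dist_triangle {f g k : X → ℝ} (hf : Measurable f) (hg : Measurable g)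
    (hk : Measurable k) : l2Dist ν h f k ≤ l2Dist ν h f g + l2Dist ν h g k := by
  have hsplit : (fun x => f x - k x) = (fun x => f x - g x) + fun x => g x - k x := by
    ext x
    simp
  rw [l2Dist, hsplit]
  exact eLpNorm_add_le (hf.sub hg).aestronglyMeasurable (hg.sub hk).aestronglyMeasurable one_le_two

/-- `N` is an `ε`-packing of `F` in the `L₂(h)` distance; the packing number is the maximal
cardinality of such a set. -/
structure IsPacking (ν : Measure X) (h : X → ℝ) (F : Set (X → ℝ)) (ε : ℝ)
    (N : Finset (X → ℝ)) : Prop where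
  subset : (N : Set (X → ℝ)) ⊆ F
  pairwise : (N : Set (X → ℝ)).Pairwise fun f g => ENNReal.ofReal ε < l2Dist ν h f g

lemma IsPacking.card_le_packingNumber (hN : IsPacking ν h F ε N) :
    (N.card : ℕ∞) ≤ packingNumber ν h F ε :=
  le_iSup₂_of_le (f := fun (N : Finset (X → ℝ)) (_ : (N : Set (X → ℝ)) ⊆ F ∧
    (N : Set (X → ℝ)).Pairwise fun f g => ENNReal.ofReal ε < l2Dist ν h f g) => (N.card : ℕ∞))
    N ⟨hN.subset, hN.pairwise⟩ le_rfl

lemma exists_isPacking_card_eq_packingNumber (htop : packingNumber ν h F ε ≠ ⊤) :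
    ∃ N, IsPacking ν h F ε N ∧ (N.card : ℕ∞) = packingNumber ν h F ε := by
  rw [packingNumber, iSup_subtype'] at htop ⊢
  have : Nonempty {N : Finset (X → ℝ) // (N : Set (X → ℝ)) ⊆ F ∧
      (N : Set (X → ℝ)).Pairwise fun f g => ENNReal.ofReal ε < l2Dist ν h f g} := ⟨⟨∅, by simp⟩⟩
  obtain ⟨N, hN⟩ := ENat.exists_eq_iSup_of_lt_top htop.lt_top
  exact ⟨N, ⟨N.2.1, N.2.2⟩, hN⟩

lemma IsPacking.exists_l2Dist_le (hN : IsPacking ν h F ε N)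
    (hcard : (N.card : ℕ∞) = packingNumber ν h F ε) {f : X → ℝ} (hf : f ∈ F) :
    ∃ g ∈ N, l2Dist ν h f g ≤ ENNReal.ofReal ε := by
  classical
  by_contra! hfar
  have hfN : f ∉ N := fun hfN => by simpa [l2Dist_self] using hfar f hfN
  have hinsert : IsPacking ν h F ε (insert f N) := by
    constructor <;> rw [Finset.coe_insert]
    · exact Set.insert_subset hf hN.subset
    · exact hN.pairwise.insert fun g hg _ => ⟨hfar g hg, l2Dist_comm f g ▸ hfar g hg⟩
  have hle := hinsert.card_le_packingNumber
  rw [← hcard, Finset.card_insert_of_notMem hfN, Nat.cast_le] at hle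
  exact absurd hle (by simp)

lemma exists_isPacking_log_card_eq (hF : IsTotallyBounded ν h F) (hε : 0 < ε) :
    ∃ N, IsPacking ν h F ε N ∧ Real.log N.card = packingEntropy ν h F ε ∧
      ∀ f ∈ F, ∃ g ∈ N, l2Dist ν h f g ≤ ENNReal.ofReal ε := by
  obtain ⟨N, hN, hcard⟩ := exists_isPacking_card_eq_packingNumber (hF ε hε)
  refine ⟨N, hN, ?_, fun f hf => hN.exists_l2Dist_le hcard hf⟩
  rw [packingEntropy, ← hcard, ENat.toNat_natCast]

lemma packingNumber_antitone : Antitone (packingNumber ν h F) := fun _ _ hab =>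
  iSup_mono fun _ => iSup_mono' fun hN =>
    ⟨⟨hN.1, hN.2.mono' fun _ _ h => (ENNReal.ofReal_le_ofReal hab).trans_lt h⟩, le_rfl⟩

lemma packingEntropy_nonneg (ε : ℝ) : 0 ≤ packingEntropy ν h F ε := Real.log_natCast_nonneg _

lemma packingEntropy_antitoneOn (hF : IsTotallyBounded ν h F) :
    AntitoneOn (packingEntropy ν h F) (Set.Ioi 0) := fun ε hε δ _ hεδ => by
  have hle := ENat.toNat_le_toNat (packingNumber_antitone (F := F) hεδ) (hF ε hε)
  rcases Nat.eq_zero_or_pos (packingNumber ν h F δ).toNat with h₀ | h₀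
  · simpa [packingEntropy, h₀] using packingEntropy_nonneg (ν := ν) (h := h) (F := F) ε
  · exact Real.log_le_log (by exact_mod_cast h₀) (by exact_mod_cast hle)

end Packing

/-! ### Product measures -/

section Pi

variable {ι : Type*} [Fintype ι] {Ω : ι → Type*}

lemma prod_indicator_eq_indicator_pi (A : ∀ i, Set (Ω i)) (L : ∀ i, Ω i → ℝ≥0∞) (d : ∀ i, Ω i) :
    ∏ i, (A i).indicator (L i) (d i) = (Set.univ.pi A).indicator (fun d => ∏ i, L i (d i)) d := by
  by_cases hd : d ∈ Set.univ.pi A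
  · rw [Set.indicator_of_mem hd]
    exact Finset.prod_congr rfl fun i _ => Set.indicator_of_mem (hd i trivial) _
  · rw [Set.indicator_of_notMem hd]
    simp only [Set.mem_pi, Set.mem_univ, true_imp_iff, not_forall] at hd
    obtain ⟨i, hi⟩ := hd
    exact Finset.prod_eq_zero (Finset.mem_univ i) (Set.indicator_of_notMem hi _)

variable [∀ i, MeasurableSpace (Ω i)]

lemma lintegral_pi_prod (P : ∀ i, Measure (Ω i)) [∀ i, IsProbabilityMeasure (P i)]
    {F : ∀ i, Ω i → ℝ≥0∞} (hF : ∀ i, Measurable (F i)) :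
    ∫⁻ d, ∏ i, F i (d i) ∂Measure.pi P = ∏ i, ∫⁻ x, F i x ∂P i := by
  rw [ProbabilityTheory.lintegral_prod_eq_prod_lintegral_of_indepFun Finset.univ
    (fun i (d : ∀ i, Ω i) => F i (d i))
    (ProbabilityTheory.iIndepFun_pi (X := F) fun i => (hF i).aemeasurable)
    (fun i => (hF i).comp (measurable_pi_apply i))]
  exact Finset.prod_congr rfl fun i _ => (measurePreserving_eval P i).lintegral_comp (hF i)

lemma lintegral_pi_prod_le_ofReal_exp {Ω : Type*} [MeasurableSpace Ω] {P : Measure Ω}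
    [IsProbabilityMeasure P] {F : Ω → ℝ≥0∞} (hF : Measurable F) {t : ℝ}
    (h : ∫⁻ x, F x ∂P ≤ ENNReal.ofReal (Real.exp t)) (n : ℕ) :
    ∫⁻ d, ∏ i, F (d i) ∂Measure.pi (fun _ : Fin n => P) ≤ ENNReal.ofReal (Real.exp (n * t)) := by
  rw [lintegral_pi_prod (fun _ => P) fun _ => hF, Finset.prod_const, Finset.card_univ,
    Fintype.card_fin, Real.exp_nat_mul, ENNReal.ofReal_pow (Real.exp_nonneg t)]
  gcongr

lemma pi_withDensity (P : ∀ i, Measure (Ω i)) [∀ i, IsProbabilityMeasure (P i)]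
    {L : ∀ i, Ω i → ℝ≥0∞} (hL : ∀ i, Measurable (L i))
    [∀ i, SigmaFinite ((P i).withDensity (L i))] :
    Measure.pi (fun i => (P i).withDensity (L i)) =
      (Measure.pi P).withDensity fun d => ∏ i, L i (d i) := by
  refine Measure.pi_eq fun A hA => ?_
  rw [withDensity_apply _ (MeasurableSet.univ_pi hA),
    ← lintegral_indicator (MeasurableSet.univ_pi hA)]
  simp_rw [← prod_indicator_eq_indicator_pi]
  rw [lintegral_pi_prod P fun i => (hL i).indicator (hA i)]
  refine Finset.prod_congr rfl fun i _ => ?_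
  rw [lintegral_indicator (hA i), withDensity_apply _ (hA i)]

end Pi

lemma lintegral_ofReal_one_add_le {Ω : Type*} [MeasurableSpace Ω] {P : Measure Ω}
    [IsProbabilityMeasure P] {q : Ω → ℝ} (hq : Integrable q P) (hq₀ : ∀ x, 0 ≤ 1 + q x) :
    ∫⁻ x, ENNReal.ofReal (1 + q x) ∂P ≤ ENNReal.ofReal (Real.exp (∫ x, q x ∂P)) := by
  have hint : Integrable (fun x => 1 + q x) P := (integrable_const 1).add hq
  rw [← ofReal_integral_eq_lintegral_ofReal hint (Eventually.of_forall hq₀),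
    integral_add (integrable_const 1) hq, integral_const, probReal_univ, one_smul, add_comm]
  exact ENNReal.ofReal_le_ofReal (Real.add_one_le_exp _)

/-! ### The regression model -/

lemma abs_sub_le_two_mul {X : Type*} {f g : X → ℝ} {J : ℝ} (hf : ∀ x, |f x| ≤ J)
    (hg : ∀ x, |g x| ≤ J) (x : X) : |f x - g x| ≤ 2 * J :=
  (abs_sub _ _).trans (by linarith [hf x, hg x])

section Model

variable {X : Type*} [MeasurableSpace X] {ν : Measure X} {h h₀ : X → ℝ} {f g : X → ℝ} {C J : ℝ}

lemma IsDensity.isProbabilityMeasure (hh : IsDensity ν h) :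
    IsProbabilityMeasure (designLaw ν h) :=
  ⟨by rw [designLaw, withDensity_apply _ MeasurableSet.univ, Measure.restrict_univ,
    hh.lintegral_eq_one]⟩

lemma l2Dist_sq (f g : X → ℝ) :
    l2Dist ν h f g ^ 2 = ∫⁻ x, ENNReal.ofReal ((f x - g x) ^ 2) ∂designLaw ν h := by
  have hpow := eLpNorm_nnreal_pow_eq_lintegral (f := fun x => f x - g x) (μ := designLaw ν h)
    (p := 2) two_ne_zero
  simp only [ENNReal.coe_ofNat, NNReal.coe_ofNat, ENNReal.rpow_ofNat] at hpow
  rw [l2Dist, hpow]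
  refine lintegral_congr fun x => ?_
  rw [← ofReal_norm, ← ENNReal.ofReal_pow (norm_nonneg _), Real.norm_eq_abs, sq_abs]

lemma integrable_sq_sub [IsFiniteMeasure (designLaw ν h)] (hf : Measurable f) (hg : Measurable g)
    (hfJ : ∀ x, |f x| ≤ J) (hgJ : ∀ x, |g x| ≤ J) :
    Integrable (fun x => (f x - g x) ^ 2) (designLaw ν h) :=
  Integrable.of_bound ((hf.sub hg).pow_const 2).aestronglyMeasurable ((2 * J) ^ 2)
    (Eventually.of_forall fun x => by
      rw [norm_pow]
      exact pow_le_pow_left₀ (norm_nonneg _) (abs_sub_le_two_mul hfJ hgJ x) 2)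

lemma l2Dist_sq_eq_ofReal (hfg : Integrable (fun x => (f x - g x) ^ 2) (designLaw ν h)) :
    l2Dist ν h f g ^ 2 = ENNReal.ofReal (∫ x, (f x - g x) ^ 2 ∂designLaw ν h) := by
  rw [l2Dist_sq, ofReal_integral_eq_lintegral_ofReal hfg
    (Eventually.of_forall fun x => sq_nonneg _)]

lemma designLaw_le (hh₀ : Measurable h₀) (hC : 0 ≤ C) (hle : ∀ᵐ x ∂ν, h x ≤ C * h₀ x) :
    designLaw ν h ≤ ENNReal.ofReal C • designLaw ν h₀ := by
  rw [designLaw, designLaw, ← withDensity_smul _ hh₀.ennreal_ofReal]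
  refine withDensity_mono ?_
  filter_upwards [hle] with x hx
  rw [Pi.smul_apply, smul_eq_mul, ← ENNReal.ofReal_mul hC]
  exact ENNReal.ofReal_le_ofReal hx

lemma l2Dist_sq_le_mul (hh₀ : Measurable h₀) (hC : 0 ≤ C) (hle : ∀ᵐ x ∂ν, h x ≤ C * h₀ x)
    (f g : X → ℝ) : l2Dist ν h f g ^ 2 ≤ ENNReal.ofReal C * l2Dist ν h₀ f g ^ 2 := by
  rw [l2Dist_sq, l2Dist_sq, ← smul_eq_mul, ← lintegral_smul_measure]
  exact lintegral_mono' (designLaw_le hh₀ hC hle) le_rfl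

variable {φ s : ℝ} {μ σ : X → ℝ}

lemma measurable_observation (hμ : Measurable μ) (hσ : Measurable σ) :
    Measurable fun p : X × ℝ => (p.1, μ p.1 + σ p.1 * p.2) := by fun_prop

lemma lintegral_observationLaw [SFinite (errorLaw φ s)] (hμ : Measurable μ) (hσ : Measurable σ)
    {F : X × ℝ → ℝ≥0∞} (hF : Measurable F) :
    ∫⁻ p, F p ∂observationLaw ν φ s μ σ h =
      ∫⁻ x, ∫⁻ e, F (x, μ x + σ x * e) ∂errorLaw φ s ∂designLaw ν h := by
  rw [observationLaw, lintegral_map hF (measurable_observation hμ hσ), lintegral_prod]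
  exact (hF.comp (measurable_observation hμ hσ)).aemeasurable

lemma isProbabilityMeasure_observationLaw [IsProbabilityMeasure (designLaw ν h)]
    [IsProbabilityMeasure (errorLaw φ s)] (hμ : Measurable μ) (hσ : Measurable σ) :
    IsProbabilityMeasure (observationLaw ν φ s μ σ h) :=
  Measure.isProbabilityMeasure_map (measurable_observation hμ hσ).aemeasurable

lemma isProbabilityMeasure_sampleLaw [IsProbabilityMeasure (designLaw ν h)]
    [IsProbabilityMeasure (errorLaw φ s)] (hμ : Measurable μ) (hσ : Measurable σ) (n : ℕ) :
    IsProbabilityMeasure (sampleLaw ν φ s μ σ h n) := by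
  have := isProbabilityMeasure_observationLaw (ν := ν) (φ := φ) (s := s) (h := h) hμ hσ
  unfold sampleLaw
  infer_instance

end Model

/-! ### Exponentially weighted aggregation -/

section GibbsWeight

variable {Θ : Type*} {G : Finset Θ} {f g : Θ}

/-- The weight of `g` in the Gibbs distribution on the finite set `G` with energy `ℓ`, that is, the
posterior weight of `g` under the uniform prior on `G` and the log-likelihood `-ℓ`. -/
noncomputable def gibbsWeight (G : Finset Θ) (ℓ : Θ → ℝ) (g : Θ) : ℝ :=
  Real.exp (-ℓ g) / ∑ f ∈ G, Real.exp (-ℓ f)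

lemma gibbsWeight_nonneg (G : Finset Θ) (ℓ : Θ → ℝ) (g : Θ) : 0 ≤ gibbsWeight G ℓ g := by
  unfold gibbsWeight; positivity

lemma sum_gibbsWeight (hG : G.Nonempty) (ℓ : Θ → ℝ) : ∑ g ∈ G, gibbsWeight G ℓ g = 1 := by
  unfold gibbsWeight
  rw [← Finset.sum_div, div_self (Finset.sum_pos (fun _ _ => Real.exp_pos _) hG).ne']

lemma gibbsWeight_le (hf : f ∈ G) (ℓ : Θ → ℝ) (g : Θ) :
    gibbsWeight G ℓ g ≤ Real.exp (ℓ f - ℓ g) := by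
  have hsum : Real.exp (-ℓ f) ≤ ∑ f ∈ G, Real.exp (-ℓ f) :=
    Finset.single_le_sum (f := fun f => Real.exp (-ℓ f)) (fun _ _ => (Real.exp_pos _).le) hf
  calc gibbsWeight G ℓ g ≤ Real.exp (-ℓ g) / Real.exp (-ℓ f) := by unfold gibbsWeight; gcongr
    _ = Real.exp (ℓ f - ℓ g) := by rw [← Real.exp_sub]; ring_nf

lemma measurable_gibbsWeight {Ω : Type*} [MeasurableSpace Ω] {ℓ : Ω → Θ → ℝ}
    (hℓ : ∀ g ∈ G, Measurable fun ω => ℓ ω g) (hg : g ∈ G) :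
    Measurable fun ω => gibbsWeight G (ℓ ω) g :=
  (hℓ g hg).neg.exp.div (Finset.measurable_fun_sum _ fun f hf => (hℓ f hf).neg.exp)

lemma sum_gibbsWeight_mul_le (hf : f ∈ G) (ℓ D : Θ → ℝ) (A : ℝ) :
    ∑ g ∈ G, gibbsWeight G ℓ g * D g ≤
      A + ∑ g ∈ G, Real.exp (D g - A) * Real.exp (ℓ f - ℓ g) :=
  calc ∑ g ∈ G, gibbsWeight G ℓ g * D g
      ≤ ∑ g ∈ G, gibbsWeight G ℓ g * (A + Real.exp (D g - A)) := by
        gcongr with g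
        · exact gibbsWeight_nonneg G ℓ g
        · linarith [Real.add_one_le_exp (D g - A)]
    _ = A + ∑ g ∈ G, Real.exp (D g - A) * gibbsWeight G ℓ g := by
        simp only [mul_add, Finset.sum_add_distrib, ← Finset.sum_mul, sum_gibbsWeight ⟨f, hf⟩,
          one_mul, mul_comm (Real.exp _)]
    _ ≤ A + ∑ g ∈ G, Real.exp (D g - A) * Real.exp (ℓ f - ℓ g) := by
        gcongr with g
        exact gibbsWeight_le hf ℓ g

lemma lintegral_sum_gibbsWeight_mul_le {Ω : Type*} [MeasurableSpace Ω] {P : Measure Ω}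
    [IsProbabilityMeasure P] {ℓ : Ω → Θ → ℝ} (hℓ : ∀ g ∈ G, Measurable fun ω => ℓ ω g)
    (hf : f ∈ G) {D : Θ → ℝ} {B : ℝ} (hB : 0 ≤ B)
    (h : ∀ g ∈ G, ∫⁻ ω, ENNReal.ofReal (Real.exp (ℓ ω f - ℓ ω g)) ∂P ≤
      ENNReal.ofReal (Real.exp (B - D g))) :
    ∫⁻ ω, ENNReal.ofReal (∑ g ∈ G, gibbsWeight G (ℓ ω) g * D g) ∂P ≤
      ENNReal.ofReal (Real.log G.card + B + 1) := by
  have hcard : (0 : ℝ) < G.card := by exact_mod_cast Finset.card_pos.2 ⟨f, hf⟩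
  set A := Real.log G.card + B with hA
  have hA₀ : 0 ≤ A := add_nonneg (Real.log_natCast_nonneg _) hB
  calc ∫⁻ ω, ENNReal.ofReal (∑ g ∈ G, gibbsWeight G (ℓ ω) g * D g) ∂P
      ≤ ∫⁻ ω, (ENNReal.ofReal A + ∑ g ∈ G, ENNReal.ofReal (Real.exp (D g - A)) *
          ENNReal.ofReal (Real.exp (ℓ ω f - ℓ ω g))) ∂P := by
        refine lintegral_mono fun ω => ?_
        simp only [← ENNReal.ofReal_mul (Real.exp_nonneg _)]
        rw [← ENNReal.ofReal_sum_of_nonneg fun _ _ => by positivity,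
          ← ENNReal.ofReal_add hA₀ (by positivity)]
        exact ENNReal.ofReal_le_ofReal (sum_gibbsWeight_mul_le hf (ℓ ω) D A)
    _ = ENNReal.ofReal A + ∑ g ∈ G, ENNReal.ofReal (Real.exp (D g - A)) *
          ∫⁻ ω, ENNReal.ofReal (Real.exp (ℓ ω f - ℓ ω g)) ∂P := by
        have hm : ∀ g ∈ G, Measurable fun ω => ENNReal.ofReal (Real.exp (ℓ ω f - ℓ ω g)) :=
          fun g hg => ((hℓ f hf).sub (hℓ g hg)).exp.ennreal_ofReal
        rw [lintegral_add_left measurable_const, lintegral_const, measure_univ, mul_one,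
          lintegral_finsetSum _ fun g hg => (hm g hg).const_mul _]
        exact congrArg _ (Finset.sum_congr rfl fun g hg => lintegral_const_mul _ (hm g hg))
    _ ≤ ENNReal.ofReal A + ∑ g ∈ G, ENNReal.ofReal (Real.exp (D g - A)) *
          ENNReal.ofReal (Real.exp (B - D g)) := by
        gcongr with g hg
        exact h g hg
    _ = ENNReal.ofReal (A + 1) := by
        have hterm (g : Θ) : Real.exp (D g - A) * Real.exp (B - D g) = (G.card : ℝ)⁻¹ := by
          rw [← Real.exp_add, ← Real.exp_log (inv_pos.2 hcard), Real.log_inv, hA]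
          ring_nf
        simp only [← ENNReal.ofReal_mul (Real.exp_nonneg _), hterm]
        rw [← ENNReal.ofReal_sum_of_nonneg fun _ _ => by positivity, Finset.sum_const,
          nsmul_eq_mul, mul_inv_cancel₀ hcard.ne', ENNReal.ofReal_add hA₀ zero_le_one]

end GibbsWeight

section Aggregate

variable {X : Type*} {φ β : ℝ} {n : ℕ} {G : Finset (X → ℝ)} {g : X → ℝ}

/-- The empirical expectile loss of the regression function `g` on the sample `d`. -/
noncomputable def empiricalLoss (φ : ℝ) (d : Fin n → X × ℝ) (g : X → ℝ) : ℝ :=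
  ∑ i, expectileLoss φ ((d i).2 - g (d i).1)

/-- The exponentially weighted aggregate of the functions in `G` with inverse temperature `β`,
which is the estimator that attains the upper bound when `G` is a maximal packing. -/
noncomputable def expAggregate (φ β : ℝ) (G : Finset (X → ℝ)) (d : Fin n → X × ℝ) (x : X) : ℝ :=
  ∑ g ∈ G, gibbsWeight G (fun f => β * empiricalLoss φ d f) g * g x

lemma expAggregate_sub_sq_le (hG : G.Nonempty) (d : Fin n → X × ℝ) (x : X) (y : ℝ) :
    (expAggregate φ β G d x - y) ^ 2 ≤
      ∑ g ∈ G, gibbsWeight G (fun f => β * empiricalLoss φ d f) g * (g x - y) ^ 2 := by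
  have hsum := sum_gibbsWeight hG fun f => β * empiricalLoss φ d f
  have hsub : expAggregate φ β G d x - y =
      ∑ g ∈ G, gibbsWeight G (fun f => β * empiricalLoss φ d f) g • (g x - y) := by
    simp only [smul_eq_mul, mul_sub, Finset.sum_sub_distrib, ← Finset.sum_mul, hsum, one_mul]
    rfl
  rw [hsub]
  exact (Even.convexOn_pow even_two).map_sum_le (fun g _ => gibbsWeight_nonneg G _ g) hsum
    fun _ _ => Set.mem_univ _

variable [MeasurableSpace X]

lemma measurable_empiricalLoss (hg : Measurable g) :
    Measurable fun d : Fin n → X × ℝ => empiricalLoss φ d g := by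
  unfold empiricalLoss
  fun_prop

lemma measurable_expAggregate (hG : ∀ g ∈ G, Measurable g) :
    Measurable (Function.uncurry (expAggregate φ β G (n := n))) := by
  unfold expAggregate Function.uncurry
  refine Finset.measurable_fun_sum _ fun g hg => ?_
  refine Measurable.mul ?_ ((hG g hg).comp measurable_snd)
  exact (measurable_gibbsWeight (fun f hf => (measurable_empiricalLoss (hG f hf)).const_mul β)
    hg).comp measurable_fst

lemma l2Dist_expAggregate_sq_le {ν : Measure X} {h μ : X → ℝ} (hG : G.Nonempty)
    (hint : ∀ g ∈ G, Integrable (fun x => (g x - μ x) ^ 2) (designLaw ν h))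
    (d : Fin n → X × ℝ) :
    l2Dist ν h (expAggregate φ β G d) μ ^ 2 ≤
      ENNReal.ofReal (∑ g ∈ G, gibbsWeight G (fun f => β * empiricalLoss φ d f) g *
        ∫ x, (g x - μ x) ^ 2 ∂designLaw ν h) := by
  simp_rw [← integral_const_mul]
  rw [← integral_finsetSum _ fun g hg => (hint g hg).const_mul _,
    ofReal_integral_eq_lintegral_ofReal
      (integrable_finsetSum _ fun g hg => (hint g hg).const_mul _)
      (Eventually.of_forall fun x => Finset.sum_nonneg fun g _ =>
        mul_nonneg (gibbsWeight_nonneg G _ g) (sq_nonneg _)), l2Dist_sq]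
  exact lintegral_mono fun x => ENNReal.ofReal_le_ofReal (expAggregate_sub_sq_le hG d x (μ x))

end Aggregate

lemma exp_sub_le_one_add {p q : ℝ} (hp : 0 ≤ p) (hp₁ : p ≤ 1) (hq : 0 ≤ q) (hq₁ : q ≤ 1 / 2) :
    Real.exp (p - q) ≤ 1 + (2 * p - q / 2) := by
  have hexp := (abs_le.1 (Real.abs_exp_sub_one_sub_id_le (x := p - q)
    (abs_le.2 ⟨by linarith, by linarith⟩))).2
  nlinarith [mul_nonneg hp hq, mul_nonneg hp (sub_nonneg.2 hp₁), mul_nonneg hq (sub_nonneg.2 hq₁)]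

section ExpLoss

variable {φ c r β J : ℝ}

lemma lintegral_exp_expectileLoss_sub_le {P : Measure ℝ} {κ : NNReal}
    (hκ : ProbabilityTheory.HasSubgaussianMGF (expectileScore φ) κ P) (hc : 0 ≤ c)
    (hφ : c ≤ φ) (hφ' : c ≤ 1 - φ) (hβ : 0 ≤ β) (hβκ : 8 * κ * r ^ 2 * β ≤ c) (hr : 0 ≤ r)
    (a₀ a : ℝ) :
    ∫⁻ e, ENNReal.ofReal (Real.exp (β * (expectileLoss φ (r * e - a₀) -
        expectileLoss φ (r * e - a)))) ∂P ≤
      ENNReal.ofReal (Real.exp (2 * β * a₀ ^ 2 - β * c / 2 * a ^ 2)) := by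
  set t := 2 * β * r * (a - a₀) with ht
  have hloss (e : ℝ) : β * (expectileLoss φ (r * e - a₀) - expectileLoss φ (r * e - a)) ≤
      t * expectileScore φ e + β * (a₀ ^ 2 - c * a ^ 2) := by
    have hle := expectileLoss_sub_le (φ := φ) (C := 1) (by linarith) (by linarith) (r * e) a₀
    have hge := le_expectileLoss_sub hφ hφ' (r * e) a
    rw [expectileScore_mul hr] at hle hge
    calc β * (expectileLoss φ (r * e - a₀) - expectileLoss φ (r * e - a))
        ≤ β * (2 * (a - a₀) * (r * expectileScore φ e) + (a₀ ^ 2 - c * a ^ 2)) := by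
          gcongr; linarith
      _ = t * expectileScore φ e + β * (a₀ ^ 2 - c * a ^ 2) := by rw [ht]; ring
  have hvar : κ * t ^ 2 / 2 ≤ β * (c / 2 * (a ^ 2 + a₀ ^ 2)) := by
    have hsq : (a - a₀) ^ 2 ≤ 2 * (a ^ 2 + a₀ ^ 2) := by nlinarith [sq_nonneg (a + a₀)]
    calc κ * t ^ 2 / 2 = β * (8 * κ * r ^ 2 * β / 4 * (a - a₀) ^ 2) := by rw [ht]; ring
      _ ≤ β * (c / 4 * (2 * (a ^ 2 + a₀ ^ 2))) := by gcongr
      _ = β * (c / 2 * (a ^ 2 + a₀ ^ 2)) := by ring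
  have hc₁ : c * a₀ ^ 2 ≤ 1 * a₀ ^ 2 := by gcongr; linarith
  calc ∫⁻ e, ENNReal.ofReal (Real.exp (β * (expectileLoss φ (r * e - a₀) -
        expectileLoss φ (r * e - a)))) ∂P
      ≤ ∫⁻ e, ENNReal.ofReal (Real.exp (t * expectileScore φ e)) *
          ENNReal.ofReal (Real.exp (β * (a₀ ^ 2 - c * a ^ 2))) ∂P := by
        gcongr with e
        rw [← ENNReal.ofReal_mul (Real.exp_nonneg _), ← Real.exp_add]
        gcongr
        exact hloss e
    _ ≤ ENNReal.ofReal (Real.exp (κ * t ^ 2 / 2)) *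
          ENNReal.ofReal (Real.exp (β * (a₀ ^ 2 - c * a ^ 2))) := by
        rw [lintegral_mul_const _ (by fun_prop)]
        gcongr
        exact lintegral_exp_le_of_hasSubgaussianMGF hκ t
    _ ≤ ENNReal.ofReal (Real.exp (2 * β * a₀ ^ 2 - β * c / 2 * a ^ 2)) := by
        rw [← ENNReal.ofReal_mul (Real.exp_nonneg _), ← Real.exp_add]
        gcongr
        nlinarith

lemma exp_quadratic_le_one_add (hc : 0 ≤ c) (hc₁ : c ≤ 1) (hβ : 0 ≤ β) (hβJ : 8 * J ^ 2 * β ≤ 1)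
    {a₀ a : ℝ} (ha₀ : |a₀| ≤ 2 * J) (ha : |a| ≤ 2 * J) :
    Real.exp (2 * β * a₀ ^ 2 - β * c / 2 * a ^ 2) ≤
      1 + (4 * β * a₀ ^ 2 - β * c / 4 * a ^ 2) := by
  have hsq {u : ℝ} (hu : |u| ≤ 2 * J) : u ^ 2 * β ≤ 1 / 2 := by
    have hle : u ^ 2 ≤ (2 * J) ^ 2 := sq_le_sq' (abs_le.1 hu).1 (abs_le.1 hu).2
    linarith [mul_le_mul_of_nonneg_right hle hβ]
  have ha' : c * (a ^ 2 * β) ≤ 1 * (1 / 2) := by gcongr; exact hsq ha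
  refine (exp_sub_le_one_add (by positivity) ?_ (by positivity) ?_).trans_eq (by ring)
  · linarith [hsq ha₀]
  · linarith

end ExpLoss

section Risk

variable {X : Type*} [MeasurableSpace X] {ν : Measure X} {h : X → ℝ} {φ s : ℝ} {μ σ f g : X → ℝ}
  {c b β J : ℝ} {κ : NNReal}

lemma lintegral_exp_loss_sub_observationLaw_le [IsProbabilityMeasure (designLaw ν h)]
    [IsProbabilityMeasure (errorLaw φ s)]
    (hκ : ProbabilityTheory.HasSubgaussianMGF (expectileScore φ) κ (errorLaw φ s)) (hc : 0 ≤ c)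
    (hφ : c ≤ φ) (hφ' : c ≤ 1 - φ) (hβ : 0 ≤ β) (hβκ : 8 * κ * b ^ 2 * β ≤ c)
    (hβJ : 8 * J ^ 2 * β ≤ 1) (hμ : Measurable μ) (hμJ : ∀ x, |μ x| ≤ J) (hσ : Measurable σ)
    (hσ₀ : ∀ x, 0 ≤ σ x) (hσb : ∀ x, σ x ≤ b) (hf : Measurable f) (hfJ : ∀ x, |f x| ≤ J)
    (hg : Measurable g) (hgJ : ∀ x, |g x| ≤ J) :
    ∫⁻ p, ENNReal.ofReal (Real.exp (β * (expectileLoss φ (p.2 - f p.1) -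
        expectileLoss φ (p.2 - g p.1)))) ∂observationLaw ν φ s μ σ h ≤
      ENNReal.ofReal (Real.exp (4 * β * ∫ x, (f x - μ x) ^ 2 ∂designLaw ν h -
        β * c / 4 * ∫ x, (g x - μ x) ^ 2 ∂designLaw ν h)) := by
  have hfi := (integrable_sq_sub (ν := ν) (h := h) hf hμ hfJ hμJ).const_mul (4 * β)
  have hgi := (integrable_sq_sub (ν := ν) (h := h) hg hμ hgJ hμJ).const_mul (β * c / 4)
  have hquad (x : X) := exp_quadratic_le_one_add hc (by linarith) hβ hβJ
    (abs_sub_le_two_mul hfJ hμJ x) (abs_sub_le_two_mul hgJ hμJ x)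
  rw [lintegral_observationLaw hμ hσ (by fun_prop), ← integral_const_mul, ← integral_const_mul,
    ← integral_sub hfi hgi]
  refine (lintegral_mono fun x => ?_).trans
    (lintegral_ofReal_one_add_le (hfi.sub hgi) fun x => (Real.exp_nonneg _).trans (hquad x))
  have hβσ : 8 * κ * σ x ^ 2 * β ≤ c := by
    refine le_trans ?_ hβκ
    gcongr
    exacts [hσ₀ x, hσb x]
  have hsub (k : X → ℝ) (e : ℝ) : μ x + σ x * e - k x = σ x * e - (k x - μ x) := by ring
  simp only [hsub]
  exact (lintegral_exp_expectileLoss_sub_le hκ hc hφ hφ' hβ hβσ (hσ₀ x) _ _).trans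
    (ENNReal.ofReal_le_ofReal (hquad x))

lemma lintegral_exp_empiricalLoss_sub_le {P : Measure (X × ℝ)} [IsProbabilityMeasure P]
    (hf : Measurable f) (hg : Measurable g) {t : ℝ}
    (h : ∫⁻ p, ENNReal.ofReal (Real.exp (β * (expectileLoss φ (p.2 - f p.1) -
        expectileLoss φ (p.2 - g p.1)))) ∂P ≤ ENNReal.ofReal (Real.exp t)) (n : ℕ) :
    ∫⁻ d, ENNReal.ofReal (Real.exp (β * empiricalLoss φ d f - β * empiricalLoss φ d g))
        ∂Measure.pi (fun _ : Fin n => P) ≤ ENNReal.ofReal (Real.exp (n * t)) := by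
  refine le_of_eq_of_le (lintegral_congr fun d => ?_)
    (lintegral_pi_prod_le_ofReal_exp (by fun_prop) h n)
  rw [← ENNReal.ofReal_prod_of_nonneg fun _ _ => Real.exp_nonneg _, ← Real.exp_sum,
    ← Finset.mul_sum, Finset.sum_sub_distrib, mul_sub]
  rfl

lemma risk_expAggregate_le [IsProbabilityMeasure (designLaw ν h)]
    [IsProbabilityMeasure (errorLaw φ s)]
    (hκ : ProbabilityTheory.HasSubgaussianMGF (expectileScore φ) κ (errorLaw φ s)) (hc : 0 ≤ c)
    (hφ : c ≤ φ) (hφ' : c ≤ 1 - φ) (hβ : 0 ≤ β) (hβκ : 8 * κ * b ^ 2 * β ≤ c)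
    (hβJ : 8 * J ^ 2 * β ≤ 1) (hμ : Measurable μ) (hμJ : ∀ x, |μ x| ≤ J) (hσ : Measurable σ)
    (hσ₀ : ∀ x, 0 ≤ σ x) (hσb : ∀ x, σ x ≤ b) {G : Finset (X → ℝ)} (hG : ∀ g ∈ G, Measurable g)
    (hGJ : ∀ g ∈ G, ∀ x, |g x| ≤ J) (hf : f ∈ G) (n : ℕ) :
    ENNReal.ofReal (n * (β * c / 4)) * risk ν φ s μ σ h n (expAggregate φ β G) ≤
      ENNReal.ofReal (Real.log G.card + n * (4 * β * ∫ x, (f x - μ x) ^ 2 ∂designLaw ν h) + 1) := by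
  have := isProbabilityMeasure_observationLaw (ν := ν) (h := h) (φ := φ) (s := s) hμ hσ
  have := isProbabilityMeasure_sampleLaw (ν := ν) (h := h) (φ := φ) (s := s) hμ hσ n
  have hloss (g : X → ℝ) (hg : g ∈ G) :
      Measurable fun d : Fin n → X × ℝ => β * empiricalLoss φ d g :=
    (measurable_empiricalLoss (hG g hg)).const_mul β
  have hexp (g : X → ℝ) (hg : g ∈ G) :
      ∫⁻ d, ENNReal.ofReal (Real.exp (β * empiricalLoss φ d f - β * empiricalLoss φ d g))
        ∂sampleLaw ν φ s μ σ h n ≤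
      ENNReal.ofReal (Real.exp (n * (4 * β * ∫ x, (f x - μ x) ^ 2 ∂designLaw ν h) -
        n * (β * c / 4) * ∫ x, (g x - μ x) ^ 2 ∂designLaw ν h)) := by
    rw [mul_assoc (n : ℝ), ← mul_sub]
    exact lintegral_exp_empiricalLoss_sub_le (hG f hf) (hG g hg)
      (lintegral_exp_loss_sub_observationLaw_le hκ hc hφ hφ' hβ hβκ hβJ hμ hμJ hσ hσ₀ hσb
        (hG f hf) (hGJ f hf) (hG g hg) (hGJ g hg)) n
  rw [risk, ← lintegral_const_mul' _ _ ENNReal.ofReal_ne_top]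
  refine (lintegral_mono fun d => ?_).trans
    (lintegral_sum_gibbsWeight_mul_le hloss hf (by positivity) hexp)
  rw [l2Dist_comm]
  refine (mul_le_mul_right (l2Dist_expAggregate_sq_le ⟨f, hf⟩ (fun g hg =>
    integrable_sq_sub (hG g hg) hμ (hGJ g hg) hμJ) d) _).trans_eq ?_
  rw [← ENNReal.ofReal_mul (by positivity), Finset.mul_sum]
  simp only [mul_left_comm (gibbsWeight _ _ _)]

end Risk

lemma le_ofReal_div_of_mul_le {a y : ℝ} {x : ℝ≥0∞} (ha : 0 < a)
    (h : ENNReal.ofReal a * x ≤ ENNReal.ofReal y) : x ≤ ENNReal.ofReal (y / a) := by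
  rw [ENNReal.ofReal_div_of_pos ha, ENNReal.le_div_iff_mul_le
    (Or.inl (ENNReal.ofReal_pos.2 ha).ne') (Or.inl ENNReal.ofReal_ne_top), mul_comm]
  exact h

lemma exists_inverseTemperature {c : ℝ} (hc : 0 < c) (hc₁ : c ≤ 1) (κ : NNReal) (b J : ℝ) :
    ∃ β : ℝ, 0 < β ∧ 8 * κ * b ^ 2 * β ≤ c ∧ 8 * J ^ 2 * β ≤ 1 := by
  have hκ : 0 ≤ κ * b ^ 2 := by positivity
  have hD : 0 < 8 * (J ^ 2 + κ * b ^ 2) + 1 := by positivity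
  refine ⟨c / (8 * (J ^ 2 + κ * b ^ 2) + 1), by positivity, ?_, ?_⟩ <;>
    rw [← mul_div_assoc, div_le_iff₀ hD]
  · nlinarith [mul_nonneg hc.le (sq_nonneg J)]
  · nlinarith [mul_nonneg (sq_nonneg J) (sub_nonneg.2 hc₁)]

section UpperBound

variable {X : Type*} [MeasurableSpace X] {ν : Measure X} {φ s b C J : ℝ} {h h₀ : X → ℝ}
  {U S H : Set (X → ℝ)}

lemma integral_sq_sub_le_of_l2Dist_le [IsFiniteMeasure (designLaw ν h)] (hh₀ : Measurable h₀)
    (hC : 0 ≤ C) (hle : ∀ᵐ x ∂ν, h x ≤ C * h₀ x) {f g : X → ℝ} (hf : Measurable f)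
    (hg : Measurable g) (hfJ : ∀ x, |f x| ≤ J) (hgJ : ∀ x, |g x| ≤ J) {ε : ℝ} (hε : 0 ≤ ε)
    (hfg : l2Dist ν h₀ f g ≤ ENNReal.ofReal ε) :
    ∫ x, (f x - g x) ^ 2 ∂designLaw ν h ≤ C * ε ^ 2 := by
  rw [← ENNReal.ofReal_le_ofReal_iff (by positivity),
    ← l2Dist_sq_eq_ofReal (integrable_sq_sub hf hg hfJ hgJ), ENNReal.ofReal_mul hC,
    ENNReal.ofReal_pow hε]
  exact (l2Dist_sq_le_mul hh₀ hC hle f g).trans (by gcongr)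

lemma exists_minimaxRisk_le (hφ₀ : 0 < φ) (hφ₁ : φ < 1) (hs : 0 < s)
    (hU : ∀ μ ∈ U, Measurable μ) (hUJ : ∀ μ ∈ U, ∀ x, |μ x| ≤ J) (hS : ∀ σ ∈ S, Measurable σ)
    (hS₀ : ∀ σ ∈ S, ∀ x, 0 ≤ σ x) (hSb : ∀ σ ∈ S, ∀ x, σ x ≤ b) (hH : ∀ h ∈ H, IsDensity ν h)
    (hh₀ : Measurable h₀) (hC : 0 ≤ C) (hle : ∀ h ∈ H, ∀ᵐ x ∂ν, h x ≤ C * h₀ x)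
    (hUtb : IsTotallyBounded ν h₀ U) :
    ∃ K : ℝ, 0 < K ∧ ∀ (ε : ℝ) (n : ℕ), 0 < ε → 0 < n →
      minimaxRisk ν φ s U S H n ≤
        ENNReal.ofReal (K * ((packingEntropy ν h₀ U ε + 1) / n + ε ^ 2)) := by
  have := isProbabilityMeasure_errorLaw hφ₀ hφ₁ hs
  obtain ⟨κ, hκ⟩ := exists_hasSubgaussianMGF_expectileScore hφ₀ hφ₁ hs
  obtain ⟨c, hc, hφ, hφ'⟩ : ∃ c, 0 < c ∧ c ≤ φ ∧ c ≤ 1 - φ :=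
    ⟨min φ (1 - φ), lt_min hφ₀ (sub_pos.2 hφ₁), min_le_left _ _, min_le_right _ _⟩
  obtain ⟨β, hβ, hβκ, hβJ⟩ := exists_inverseTemperature hc (by linarith) κ b J
  set k := β * c / 4
  have hk₀ : 0 < k := by positivity
  refine ⟨k⁻¹ + k⁻¹ * (4 * β * C), by positivity, fun ε n hε hn => ?_⟩
  have hn' : (0 : ℝ) < n := by exact_mod_cast hn
  obtain ⟨G, hG, hlog, hcover⟩ := exists_isPacking_log_card_eq hUtb hε
  refine (iInf₂_le (expAggregate φ β G)
    (measurable_expAggregate fun g hg => hU g (hG.subset hg))).trans ?_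
  refine iSup₂_le fun μ hμ => iSup₂_le fun σ hσ => iSup₂_le fun h hh => ?_
  obtain ⟨f, hf, hμf⟩ := hcover μ hμ
  have := (hH h hh).isProbabilityMeasure
  have hrisk := le_ofReal_div_of_mul_le (mul_pos hn' hk₀)
    (risk_expAggregate_le (ν := ν) (h := h) hκ hc.le hφ hφ' hβ.le hβκ hβJ (hU μ hμ)
      (hUJ μ hμ) (hS σ hσ) (hS₀ σ hσ) (hSb σ hσ) (fun g hg => hU g (hG.subset hg))
      (fun g hg => hUJ g (hG.subset hg)) hf n)
  have hsq : ∫ x, (f x - μ x) ^ 2 ∂designLaw ν h ≤ C * ε ^ 2 :=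
    integral_sq_sub_le_of_l2Dist_le hh₀ hC (hle h hh) (hU f (hG.subset hf)) (hU μ hμ)
      (hUJ f (hG.subset hf)) (hUJ μ hμ) hε.le (by rwa [l2Dist_comm])
  rw [hlog] at hrisk
  refine hrisk.trans (ENNReal.ofReal_le_ofReal ?_)
  have hE : 0 ≤ (packingEntropy ν h₀ U ε + 1) / n :=
    div_nonneg (add_nonneg (packingEntropy_nonneg ε) zero_le_one) hn'.le
  calc (packingEntropy ν h₀ U ε + n * (4 * β * ∫ x, (f x - μ x) ^ 2 ∂designLaw ν h) + 1) / (n * k)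
      ≤ (packingEntropy ν h₀ U ε + n * (4 * β * (C * ε ^ 2)) + 1) / (n * k) := by gcongr
    _ = k⁻¹ * ((packingEntropy ν h₀ U ε + 1) / n) + k⁻¹ * (4 * β * C) * ε ^ 2 := by
        field_simp; ring
    _ ≤ (k⁻¹ + k⁻¹ * (4 * β * C)) * ((packingEntropy ν h₀ U ε + 1) / n + ε ^ 2) := by
        have h₁ : 0 ≤ k⁻¹ * (4 * β * C) * ((packingEntropy ν h₀ U ε + 1) / n) := by positivity
        have h₂ : 0 ≤ k⁻¹ * ε ^ 2 := by positivity
        linarith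

end UpperBound

/-! ### Likelihood ratios -/

section LikelihoodRatio

variable {X : Type*} {φ s : ℝ} {μ μ' σ : X → ℝ}

/-- The likelihood ratio of the model with location `μ'` to that with location `μ`, when both have
scale `σ` and the same design density. -/
noncomputable def likelihoodRatio (φ s : ℝ) (μ μ' σ : X → ℝ) (p : X × ℝ) : ℝ :=
  Real.exp ((expectileLoss φ ((p.2 - μ p.1) / σ p.1) -
    expectileLoss φ ((p.2 - μ' p.1) / σ p.1)) / s ^ 2)

lemma likelihoodRatio_apply {x : X} (hσ : σ x ≠ 0) (e : ℝ) :
    likelihoodRatio φ s μ μ' σ (x, μ x + σ x * e) =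
      Real.exp ((expectileLoss φ e - expectileLoss φ (e - (μ' x - μ x) / σ x)) / s ^ 2) := by
  have hμ : (μ x + σ x * e - μ x) / σ x = e := by field_simp; ring
  have hμ' : (μ x + σ x * e - μ' x) / σ x = e - (μ' x - μ x) / σ x := by field_simp; ring
  simp only [likelihoodRatio, hμ, hμ']

lemma lintegral_errorLaw_add_right (hs : 0 ≤ s) {F : ℝ → ℝ≥0∞} (hF : Measurable F) (a : ℝ) :
    ∫⁻ e, F (e + a) ∂errorLaw φ s =
      ∫⁻ e, ENNReal.ofReal (Real.exp ((expectileLoss φ e - expectileLoss φ (e - a)) / s ^ 2)) *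
        F e ∂errorLaw φ s := by
  have hpdf : Measurable fun y => ENNReal.ofReal (asymNormalPDF φ 0 s y) := by fun_prop
  rw [errorLaw, lintegral_withDensity_eq_lintegral_mul _ hpdf (by fun_prop),
    lintegral_withDensity_eq_lintegral_mul _ hpdf (by fun_prop), ← lintegral_sub_right_eq_self _ a]
  refine lintegral_congr fun e => ?_
  simp only [Pi.mul_apply, sub_add_cancel]
  rw [← mul_assoc, ← ENNReal.ofReal_mul (asymNormalPDF_nonneg hs e), asymNormalPDF_zero,
    asymNormalPDF_zero, mul_assoc, ← Real.exp_add]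
  ring_nf

lemma lintegral_exp_expectileLoss_sub_sq_le {P : Measure ℝ} {κ : NNReal}
    (hκ : ProbabilityTheory.HasSubgaussianMGF (expectileScore φ) κ P) (hφ₀ : 0 ≤ φ) (hφ₁ : φ ≤ 1)
    (s a : ℝ) :
    ∫⁻ e, ENNReal.ofReal
        (Real.exp ((expectileLoss φ e - expectileLoss φ (e - a)) / s ^ 2) ^ 2) ∂P ≤
      ENNReal.ofReal (Real.exp (8 * κ / s ^ 4 * a ^ 2)) := by
  refine (lintegral_mono fun e => ENNReal.ofReal_le_ofReal ?_).trans
    ((lintegral_exp_le_of_hasSubgaussianMGF hκ (4 * a / s ^ 2)).trans_eq (by ring_nf))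
  rw [← Real.exp_nat_mul, Real.exp_le_exp]
  have hloss := le_expectileLoss_sub hφ₀ (sub_nonneg.2 hφ₁) e a
  calc ((2 : ℕ) : ℝ) * ((expectileLoss φ e - expectileLoss φ (e - a)) / s ^ 2)
      = 2 * (expectileLoss φ e - expectileLoss φ (e - a)) / s ^ 2 := by push_cast; ring
    _ ≤ 2 * (2 * a * expectileScore φ e) / s ^ 2 := by gcongr; linarith
    _ = 4 * a / s ^ 2 * expectileScore φ e := by ring

variable [MeasurableSpace X] {ν : Measure X} {h : X → ℝ}

@[fun_prop]
lemma measurable_likelihoodRatio (hμ : Measurable μ) (hμ' : Measurable μ') (hσ : Measurable σ) :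
    Measurable (likelihoodRatio φ s μ μ' σ) := by
  unfold likelihoodRatio
  fun_prop

lemma observationLaw_eq_withDensity [SFinite (errorLaw φ s)] (hs : 0 ≤ s) (hμ : Measurable μ)
    (hμ' : Measurable μ') (hσ : Measurable σ) (hσ₀ : ∀ x, σ x ≠ 0) :
    observationLaw ν φ s μ' σ h = (observationLaw ν φ s μ σ h).withDensity
      fun p => ENNReal.ofReal (likelihoodRatio φ s μ μ' σ p) := by
  refine Measure.ext_of_lintegral _ fun F hF => ?_
  have hL : Measurable fun p => ENNReal.ofReal (likelihoodRatio φ s μ μ' σ p) := by fun_prop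
  rw [lintegral_withDensity_eq_lintegral_mul _ hL hF, lintegral_observationLaw hμ' hσ hF,
    lintegral_observationLaw hμ hσ (hL.mul hF)]
  refine lintegral_congr fun x => ?_
  have hshift (e : ℝ) : μ' x + σ x * e = μ x + σ x * (e + (μ' x - μ x) / σ x) := by
    have := hσ₀ x
    field_simp
    ring
  simp only [Pi.mul_apply, hshift, likelihoodRatio_apply (hσ₀ x)]
  exact lintegral_errorLaw_add_right (F := fun e => F (x, μ x + σ x * e)) hs (by fun_prop) _

lemma exp_le_one_add_mul_exp {x y : ℝ} (hx : 0 ≤ x) (hxy : x ≤ y) :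
    Real.exp x ≤ 1 + x * Real.exp y := by
  have hneg := mul_le_mul_of_nonneg_right (Real.add_one_le_exp (-x)) (Real.exp_nonneg x)
  rw [← Real.exp_add, neg_add_cancel, Real.exp_zero] at hneg
  calc Real.exp x ≤ 1 + x * Real.exp x := by linarith
    _ ≤ 1 + x * Real.exp y := by gcongr

lemma exists_lintegral_likelihoodRatio_sq_le (hφ₀ : 0 < φ) (hφ₁ : φ < 1) (hs : 0 < s)
    [IsProbabilityMeasure (designLaw ν h)] (J : ℝ) {τ : ℝ} (hτ : 0 < τ) (hσ : Measurable σ)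
    (hστ : ∀ x, τ ≤ σ x) :
    ∃ K : ℝ, 0 ≤ K ∧ ∀ μ μ' : X → ℝ, Measurable μ → Measurable μ' → (∀ x, |μ x| ≤ J) →
      (∀ x, |μ' x| ≤ J) →
      ∫⁻ p, ENNReal.ofReal (likelihoodRatio φ s μ μ' σ p ^ 2) ∂observationLaw ν φ s μ σ h ≤
        ENNReal.ofReal (Real.exp (K * ∫ x, (μ' x - μ x) ^ 2 ∂designLaw ν h)) := by
  have := isProbabilityMeasure_errorLaw hφ₀ hφ₁ hs
  obtain ⟨κ, hκ⟩ := exists_hasSubgaussianMGF_expectileScore hφ₀ hφ₁ hs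
  set B := 8 * κ / s ^ 4 / τ ^ 2 with hB
  have : 0 ≤ B := by positivity
  refine ⟨B * Real.exp (B * (2 * J) ^ 2), by positivity, fun μ μ' hμ hμ' hμJ hμJ' => ?_⟩
  have hint := (integrable_sq_sub (ν := ν) (h := h) hμ' hμ hμJ' hμJ).const_mul
    (B * Real.exp (B * (2 * J) ^ 2))
  rw [lintegral_observationLaw hμ hσ (by fun_prop), ← integral_const_mul]
  refine (lintegral_mono fun x => ?_).trans
    (lintegral_ofReal_one_add_le hint fun x => by positivity)
  have hσx : 0 < σ x := hτ.trans_le (hστ x)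
  simp only [likelihoodRatio_apply hσx.ne']
  refine (lintegral_exp_expectileLoss_sub_sq_le hκ hφ₀.le hφ₁.le s _).trans
    (ENNReal.ofReal_le_ofReal ?_)
  have hsq : (μ' x - μ x) ^ 2 ≤ (2 * J) ^ 2 := by
    have habs := abs_le.1 (abs_sub_le_two_mul hμJ' hμJ x)
    exact sq_le_sq' habs.1 habs.2
  calc Real.exp (8 * κ / s ^ 4 * ((μ' x - μ x) / σ x) ^ 2)
      = Real.exp (8 * κ / s ^ 4 / σ x ^ 2 * (μ' x - μ x) ^ 2) := by ring_nf
    _ ≤ Real.exp (B * (μ' x - μ x) ^ 2) := by rw [hB]; gcongr; exact hστ x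
    _ ≤ 1 + B * (μ' x - μ x) ^ 2 * Real.exp (B * (2 * J) ^ 2) :=
        exp_le_one_add_mul_exp (by positivity) (by gcongr)
    _ = 1 + B * Real.exp (B * (2 * J) ^ 2) * (μ' x - μ x) ^ 2 := by ring

end LikelihoodRatio

/-! ### Testing -/

section Testing

variable {Ω : Type*} [MeasurableSpace Ω]

lemma withDensity_ofReal_apply_le {P : Measure Ω} {A : Set Ω} (hA : MeasurableSet A) {L : Ω → ℝ}
    (hL : Measurable L) {q t : ℝ} (ht : 0 < t)
    (hLq : ∫⁻ ω, ENNReal.ofReal (L ω ^ 2) ∂P ≤ ENNReal.ofReal q) :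
    P.withDensity (fun ω => ENNReal.ofReal (L ω)) A ≤
      ENNReal.ofReal (1 / (4 * t) * q) + ENNReal.ofReal t * P A := by
  have hamgm (ω : Ω) : L ω ≤ 1 / (4 * t) * L ω ^ 2 + t := by
    have hsq : 1 / (4 * t) * L ω ^ 2 + t - L ω = (L ω - 2 * t) ^ 2 / (4 * t) := by
      field_simp
      ring
    have : 0 ≤ (L ω - 2 * t) ^ 2 / (4 * t) := by positivity
    linarith
  calc P.withDensity (fun ω => ENNReal.ofReal (L ω)) A
      = ∫⁻ ω in A, ENNReal.ofReal (L ω) ∂P := withDensity_apply _ hA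
    _ ≤ ∫⁻ ω in A, (ENNReal.ofReal (1 / (4 * t)) * ENNReal.ofReal (L ω ^ 2) +
          ENNReal.ofReal t) ∂P := lintegral_mono fun ω => by
        rw [← ENNReal.ofReal_mul (by positivity), ← ENNReal.ofReal_add (by positivity) ht.le]
        exact ENNReal.ofReal_le_ofReal (hamgm ω)
    _ = ENNReal.ofReal (1 / (4 * t)) * ∫⁻ ω in A, ENNReal.ofReal (L ω ^ 2) ∂P +
          ENNReal.ofReal t * P A := by
        rw [lintegral_add_right _ measurable_const, lintegral_const_mul _ (by fun_prop),
          setLIntegral_const]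
    _ ≤ ENNReal.ofReal (1 / (4 * t) * q) + ENNReal.ofReal t * P A := by
        rw [ENNReal.ofReal_mul (by positivity)]
        gcongr
        exact (setLIntegral_le_lintegral _ _).trans hLq

lemma exists_measure_le_add {ι κ : Type*} {I : Finset ι} (hI : I.Nonempty) {G : Finset κ}
    {P : ι → Measure Ω} {Q : κ → Measure Ω} (hQ : ∀ k ∈ G, Q k Set.univ ≤ 1) {A : ι → Set Ω}
    (hA : ∀ j ∈ I, MeasurableSet (A j)) (hdisj : (I : Set ι).PairwiseDisjoint A) {a b c : ℝ≥0∞}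
    (hle : ∀ j ∈ I, ∃ k ∈ G, P j (A j) ≤ a + b * Q k (A j))
    (hcard : b * G.card ≤ c * I.card) : ∃ j ∈ I, P j (A j) ≤ a + c := by
  by_contra! hlarge
  refine (ENNReal.sum_lt_sum_of_nonempty hI hlarge).not_ge ?_
  calc ∑ j ∈ I, P j (A j) ≤ ∑ j ∈ I, (a + b * ∑ k ∈ G, Q k (A j)) :=
        Finset.sum_le_sum fun j hj => by
          obtain ⟨k, hk, hjk⟩ := hle j hj
          refine hjk.trans ?_
          gcongr
          exact Finset.single_le_sum (f := fun k => Q k (A j)) (fun _ _ => zero_le) hk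
    _ = I.card * a + b * ∑ k ∈ G, ∑ j ∈ I, Q k (A j) := by
        rw [Finset.sum_add_distrib, ← Finset.mul_sum, Finset.sum_const, nsmul_eq_mul,
          Finset.sum_comm]
    _ ≤ I.card * a + b * ∑ _k ∈ G, 1 := by
        gcongr with k hk
        rw [← measure_biUnion_finset hdisj hA]
        exact (measure_mono (Set.subset_univ _)).trans (hQ k hk)
    _ ≤ ∑ _j ∈ I, (a + c) := by
        simp only [Finset.sum_const, nsmul_eq_mul, mul_one, mul_add]
        exact add_le_add le_rfl (hcard.trans_eq (mul_comm _ _))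

lemma ofReal_sq_div_two_le_lintegral_sq {P : Measure Ω} [IsProbabilityMeasure P] {Z : Ω → ℝ≥0∞}
    (hZ : Measurable Z) {a : ℝ} (ha : 0 ≤ a)
    (hPZ : P {ω | Z ω < ENNReal.ofReal a} ≤ ENNReal.ofReal (1 / 2)) :
    ENNReal.ofReal (a ^ 2 / 2) ≤ ∫⁻ ω, Z ω ^ 2 ∂P := by
  have hfar : ENNReal.ofReal (1 / 2) ≤ P {ω | ENNReal.ofReal a ^ 2 ≤ Z ω ^ 2} := by
    have hcompl : {ω | ENNReal.ofReal a ^ 2 ≤ Z ω ^ 2} = {ω | Z ω < ENNReal.ofReal a}ᶜ := by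
      ext ω
      simp [ENNReal.pow_le_pow_left_iff]
    rw [hcompl, prob_compl_eq_one_sub (measurableSet_lt hZ measurable_const)]
    refine le_trans ?_ (tsub_le_tsub_left hPZ 1)
    rw [← ENNReal.ofReal_one, ← ENNReal.ofReal_sub _ (by norm_num)]
    exact ENNReal.ofReal_le_ofReal (by norm_num)
  calc ENNReal.ofReal (a ^ 2 / 2) = ENNReal.ofReal a ^ 2 * ENNReal.ofReal (1 / 2) := by
        rw [← ENNReal.ofReal_pow ha, ← ENNReal.ofReal_mul (by positivity)]
        ring_nf
    _ ≤ ENNReal.ofReal a ^ 2 * P {ω | ENNReal.ofReal a ^ 2 ≤ Z ω ^ 2} := by gcongr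
    _ ≤ ∫⁻ ω, Z ω ^ 2 ∂P := mul_meas_ge_le_lintegral (hZ.pow_const 2) _

end Testing

section LowerBound

variable {X : Type*} [MeasurableSpace X] {ν : Measure X} {φ s : ℝ} {μ μ' σ h h₀ : X → ℝ}

lemma measurable_l2Dist [SFinite (designLaw ν h)] {Ω : Type*} [MeasurableSpace Ω]
    {est : Ω → X → ℝ} (hest : Measurable (Function.uncurry est)) (hμ : Measurable μ) :
    Measurable fun ω => l2Dist ν h μ (est ω) := by
  have hsqrt (ω : Ω) : l2Dist ν h μ (est ω) =
      (∫⁻ x, ENNReal.ofReal ((μ x - est ω x) ^ 2) ∂designLaw ν h) ^ (1 / 2 : ℝ) := by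
    rw [← l2Dist_sq, ← ENNReal.rpow_natCast, ← ENNReal.rpow_mul]
    simp
  simp only [hsqrt]
  refine (Measurable.lintegral_prod_right' (f := fun p : Ω × X =>
    ENNReal.ofReal ((μ p.2 - est p.1 p.2) ^ 2)) ?_).pow_const _
  exact (((hμ.comp measurable_snd).sub hest).pow_const 2).ennreal_ofReal

lemma IsPacking.pairwiseDisjoint_setOf_l2Dist_lt {F : Set (X → ℝ)} {δ : ℝ} {N : Finset (X → ℝ)}
    (hN : IsPacking ν h F δ N) (hF : ∀ f ∈ F, Measurable f) {Ω : Type*} {est : Ω → X → ℝ}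
    (hest : ∀ ω, Measurable (est ω)) :
    (N : Set (X → ℝ)).PairwiseDisjoint fun f =>
      {ω | l2Dist ν h f (est ω) < ENNReal.ofReal (δ / 2)} := by
  intro f hf g hg hfg
  refine Set.disjoint_left.2 fun ω (hfω : l2Dist ν h f (est ω) < _) hgω => ?_
  have hgω' : l2Dist ν h (est ω) g < ENNReal.ofReal (δ / 2) := by rwa [l2Dist_comm]
  have hδ : 0 ≤ δ / 2 := (ENNReal.ofReal_pos.1 (pos_of_gt hfω)).le
  have hlt : l2Dist ν h f g < ENNReal.ofReal δ :=
    calc l2Dist ν h f g ≤ l2Dist ν h f (est ω) + l2Dist ν h (est ω) g :=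
          l2Dist_triangle (hF f (hN.subset hf)) (hest ω) (hF g (hN.subset hg))
      _ < ENNReal.ofReal (δ / 2) + ENNReal.ofReal (δ / 2) := ENNReal.add_lt_add hfω hgω'
      _ = ENNReal.ofReal δ := by rw [← ENNReal.ofReal_add hδ hδ, add_halves]
  exact absurd hlt (hN.pairwise hf hg hfg).not_gt

lemma IsPacking.exists_le_lintegral_l2Dist_sq [SFinite (designLaw ν h)] {F : Set (X → ℝ)}
    (hF : ∀ f ∈ F, Measurable f) {δ : ℝ} (hδ : 0 ≤ δ) {I G : Finset (X → ℝ)}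
    (hI : IsPacking ν h F δ I) (hI₀ : 0 < I.card) (hG : (G : Set (X → ℝ)) ⊆ F) {Ω : Type*}
    [MeasurableSpace Ω] {P : (X → ℝ) → Measure Ω} (hP : ∀ f ∈ F, IsProbabilityMeasure (P f))
    {b : ℝ} (hb : 0 ≤ b) (hcard : b * G.card ≤ 1 / 4 * I.card)
    (hdom : ∀ f ∈ F, ∃ g ∈ G, ∀ A, MeasurableSet A →
      P f A ≤ ENNReal.ofReal (1 / 4) + ENNReal.ofReal b * P g A)
    {est : Ω → X → ℝ} (hest : Measurable (Function.uncurry est)) :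
    ∃ f ∈ F, ENNReal.ofReal (δ ^ 2 / 8) ≤ ∫⁻ ω, l2Dist ν h f (est ω) ^ 2 ∂P f := by
  have hmeas (f) (hf : f ∈ F) := measurable_l2Dist (ν := ν) (h := h) hest (hF f hf)
  have hmeasSet (f) (hf : f ∈ F) :
      MeasurableSet {ω | l2Dist ν h f (est ω) < ENNReal.ofReal (δ / 2)} :=
    measurableSet_lt (hmeas f hf) measurable_const
  have hcard' : ENNReal.ofReal b * G.card ≤ ENNReal.ofReal (1 / 4) * I.card := by
    rw [← ENNReal.ofReal_natCast, ← ENNReal.ofReal_natCast, ← ENNReal.ofReal_mul hb,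
      ← ENNReal.ofReal_mul (by norm_num)]
    exact ENNReal.ofReal_le_ofReal hcard
  obtain ⟨f, hfI, hf⟩ := exists_measure_le_add (Finset.card_pos.1 hI₀)
    (fun g hg => (hP g (hG hg)).measure_univ.le) (fun f hf => hmeasSet f (hI.subset hf))
    (hI.pairwiseDisjoint_setOf_l2Dist_lt hF fun ω => hest.comp measurable_prodMk_left)
    (fun f hf => by
      obtain ⟨g, hg, hfg⟩ := hdom f (hI.subset hf)
      exact ⟨g, hg, hfg _ (hmeasSet f (hI.subset hf))⟩) hcard'
  have hfF := hI.subset hfI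
  have := hP f hfF
  have hhalf : ENNReal.ofReal (1 / 4) + ENNReal.ofReal (1 / 4) = ENNReal.ofReal (1 / 2) := by
    rw [← ENNReal.ofReal_add (by norm_num) (by norm_num)]
    norm_num
  refine ⟨f, hfF, ?_⟩
  calc ENNReal.ofReal (δ ^ 2 / 8) = ENNReal.ofReal ((δ / 2) ^ 2 / 2) := by ring_nf
    _ ≤ ∫⁻ ω, l2Dist ν h f (est ω) ^ 2 ∂P f :=
        ofReal_sq_div_two_le_lintegral_sq (hmeas f hfF) (by positivity) (hhalf ▸ hf)

lemma sampleLaw_eq_withDensity [IsProbabilityMeasure (designLaw ν h)]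
    [IsProbabilityMeasure (errorLaw φ s)] (hs : 0 ≤ s) (hμ : Measurable μ) (hμ' : Measurable μ')
    (hσ : Measurable σ) (hσ₀ : ∀ x, σ x ≠ 0) (n : ℕ) :
    sampleLaw ν φ s μ' σ h n = (sampleLaw ν φ s μ σ h n).withDensity
      fun d => ENNReal.ofReal (∏ i, likelihoodRatio φ s μ μ' σ (d i)) := by
  have := isProbabilityMeasure_observationLaw (ν := ν) (φ := φ) (s := s) (h := h) hμ hσ
  have hprob := isProbabilityMeasure_observationLaw (ν := ν) (φ := φ) (s := s) (h := h) hμ' hσ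
  have hden := observationLaw_eq_withDensity (ν := ν) (h := h) (φ := φ) hs hμ hμ' hσ hσ₀
  rw [hden] at hprob
  simp only [ENNReal.ofReal_prod_of_nonneg fun _ _ => (Real.exp_pos _).le, likelihoodRatio]
  simp only [sampleLaw, hden]
  exact pi_withDensity (fun _ => observationLaw ν φ s μ σ h)
    fun _ => (measurable_likelihoodRatio hμ hμ' hσ).ennreal_ofReal

lemma exists_sampleLaw_apply_le (hφ₀ : 0 < φ) (hφ₁ : φ < 1) (hs : 0 < s)
    [IsProbabilityMeasure (designLaw ν h)] (hh : Measurable h) (J : ℝ) {τ : ℝ} (hτ : 0 < τ)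
    (hσ : Measurable σ) (hστ : ∀ x, τ ≤ σ x) :
    ∃ K : ℝ, 0 ≤ K ∧ ∀ (μ μ' : X → ℝ) (ε : ℝ) (n : ℕ) (A : Set (Fin n → X × ℝ)),
      Measurable μ → Measurable μ' → (∀ x, |μ x| ≤ J) → (∀ x, |μ' x| ≤ J) → 0 ≤ ε →
      l2Dist ν h μ' μ ≤ ENNReal.ofReal ε → MeasurableSet A →
      sampleLaw ν φ s μ' σ h n A ≤ ENNReal.ofReal (1 / 4) +
        ENNReal.ofReal (Real.exp (K * (n * ε ^ 2))) * sampleLaw ν φ s μ σ h n A := by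
  have := isProbabilityMeasure_errorLaw hφ₀ hφ₁ hs
  obtain ⟨K, hK, hLR⟩ := exists_lintegral_likelihoodRatio_sq_le (ν := ν) (h := h) hφ₀ hφ₁ hs J hτ
    hσ hστ
  refine ⟨K, hK, fun μ μ' ε n A hμ hμ' hμJ hμJ' hε hdist hA => ?_⟩
  have hL : Measurable (likelihoodRatio φ s μ μ' σ) := by fun_prop
  have hLsq : ∫⁻ p, ENNReal.ofReal (likelihoodRatio φ s μ μ' σ p ^ 2) ∂observationLaw ν φ s μ σ h ≤
      ENNReal.ofReal (Real.exp (K * ε ^ 2)) := by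
    refine (hLR μ μ' hμ hμ' hμJ hμJ').trans ?_
    gcongr
    simpa using integral_sq_sub_le_of_l2Dist_le hh zero_le_one
      (ae_of_all _ fun x => (one_mul (h x)).ge) hμ' hμ hμJ' hμJ hε hdist
  have := isProbabilityMeasure_observationLaw (ν := ν) (φ := φ) (s := s) (h := h) hμ hσ
  set t := Real.exp (K * (n * ε ^ 2)) with ht
  have ht₀ : 0 < t := Real.exp_pos _
  have hprod := lintegral_pi_prod_le_ofReal_exp (hL.pow_const 2).ennreal_ofReal hLsq n
  simp only [← ENNReal.ofReal_prod_of_nonneg fun _ _ => sq_nonneg _, Finset.prod_pow,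
    mul_left_comm (n : ℝ), ← ht] at hprod
  rw [sampleLaw_eq_withDensity hs.le hμ hμ' hσ (fun x => (hτ.trans_le (hστ x)).ne') n]
  refine (withDensity_ofReal_apply_le hA (by fun_prop) ht₀ hprod).trans_eq ?_
  rw [sampleLaw]
  congr 2
  field_simp

-- Mathlib's `Real.log 0 = 0` makes `m = 0` a case to exclude and `k = 0` a harmless one.
lemma pos_and_exp_mul_le_of_log_le {k m : ℕ} {x : ℝ} (hx : 0 ≤ x)
    (h : Real.log 4 + Real.log k + x ≤ Real.log m) :
    0 < m ∧ Real.exp x * k ≤ 1 / 4 * m := by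
  have hlog4 : 0 < Real.log 4 := Real.log_pos (by norm_num)
  have hm : 0 < m := Nat.pos_of_ne_zero fun hm => by
    rw [hm, Nat.cast_zero, Real.log_zero] at h
    linarith [Real.log_natCast_nonneg k]
  refine ⟨hm, ?_⟩
  rcases Nat.eq_zero_or_pos k with rfl | hk
  · simp
  have hexp := Real.exp_le_exp.2 h
  rw [Real.exp_add, Real.exp_add, Real.exp_log (by positivity), Real.exp_log (by positivity),
    Real.exp_log (by positivity)] at hexp
  linarith

lemma exists_le_minimaxRisk (hφ₀ : 0 < φ) (hφ₁ : φ < 1) (hs : 0 < s) {U : Set (X → ℝ)} {J τ : ℝ}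
    (hU : ∀ μ ∈ U, Measurable μ) (hUJ : ∀ μ ∈ U, ∀ x, |μ x| ≤ J) {S H : Set (X → ℝ)}
    (hσS : σ ∈ S) (hσ : Measurable σ) (hτ : 0 < τ) (hστ : ∀ x, τ ≤ σ x) (hh₀H : h₀ ∈ H)
    (hh₀ : IsDensity ν h₀) (hUtb : IsTotallyBounded ν h₀ U) :
    ∃ K : ℝ, 0 ≤ K ∧ ∀ (ε δ : ℝ) (n : ℕ), 0 < ε → 0 < δ →
      Real.log 4 + packingEntropy ν h₀ U ε + K * (n * ε ^ 2) ≤ packingEntropy ν h₀ U δ →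
      ENNReal.ofReal (δ ^ 2 / 8) ≤ minimaxRisk ν φ s U S H n := by
  have := isProbabilityMeasure_errorLaw hφ₀ hφ₁ hs
  have := hh₀.isProbabilityMeasure
  obtain ⟨K, hK, hdom⟩ := exists_sampleLaw_apply_le (ν := ν) (h := h₀) hφ₀ hφ₁ hs hh₀.measurable J
    hτ hσ hστ
  refine ⟨K, hK, fun ε δ n hε hδ hent => le_iInf₂ fun est hest => ?_⟩
  obtain ⟨G, hG, hGcard, hnet⟩ := exists_isPacking_log_card_eq hUtb hε
  obtain ⟨I, hI, hIcard, -⟩ := exists_isPacking_log_card_eq hUtb hδ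
  rw [← hGcard, ← hIcard] at hent
  obtain ⟨hIpos, hcard⟩ := pos_and_exp_mul_le_of_log_le (by positivity) hent
  obtain ⟨μ, hμ, hrisk⟩ := hI.exists_le_lintegral_l2Dist_sq hU hδ.le hIpos hG.subset
    (P := fun μ => sampleLaw ν φ s μ σ h₀ n)
    (fun μ hμ => isProbabilityMeasure_sampleLaw (hU μ hμ) hσ n) (Real.exp_pos _).le hcard
    (fun μ hμ => by
      obtain ⟨g, hg, hdist⟩ := hnet μ hμ
      have hgU := hG.subset hg
      exact ⟨g, hg, fun A => hdom g μ ε n A (hU g hgU) (hU μ hμ) (hUJ g hgU) (hUJ μ hμ) hε.le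
        hdist⟩) hest
  exact le_iSup₂_of_le μ hμ (le_iSup₂_of_le σ hσS (le_iSup₂_of_le h₀ hh₀H hrisk))

end LowerBound

/-! ### Growth of the entropy and the critical radius -/

section Entropy

variable {M E : ℝ → ℝ}

lemma IsRich.exists_eventually_mul_abs_le (hM : IsRich M) :
    ∃ α r : ℝ, 0 < α ∧ 1 < r ∧ ∀ᶠ ε in 𝓝[>] 0, M ε ≠ 0 ∧ r * |M ε| ≤ |M (α * ε)| := by
  obtain ⟨α, hα, -, hlim⟩ := hM
  obtain ⟨r, hr₁, hr⟩ := EReal.lt_iff_exists_real_btwn.1 hlim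
  have hr₁' : (1 : ℝ) < r := by exact_mod_cast hr₁
  refine ⟨α, r, hα, hr₁', ?_⟩
  filter_upwards [eventually_lt_of_lt_liminf hr] with ε hε
  have hratio : r < M (α * ε) / M ε := by exact_mod_cast hε
  have hne : M ε ≠ 0 := fun h₀ => by
    rw [h₀, div_zero] at hratio
    linarith
  refine ⟨hne, ?_⟩
  rw [← le_div_iff₀ (abs_pos.2 hne), ← abs_div]
  exact hratio.le.trans (le_abs_self _)

lemma eventually_pow_mul_abs_le {α r : ℝ} (hα : 0 < α) (hr : 0 ≤ r)
    (h : ∀ᶠ ε in 𝓝[>] 0, r * |M ε| ≤ |M (α * ε)|) (k : ℕ) :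
    ∀ᶠ ε in 𝓝[>] 0, r ^ k * |M ε| ≤ |M (α ^ k * ε)| := by
  induction k with
  | zero => simp
  | succ k ih =>
    filter_upwards [h, eventually_nhdsGT_zero_mul_left hα ih] with ε hstep hpow
    calc r ^ (k + 1) * |M ε| = r ^ k * (r * |M ε|) := by ring
      _ ≤ r ^ k * |M (α * ε)| := by gcongr
      _ ≤ |M (α ^ k * (α * ε))| := hpow
      _ = |M (α ^ (k + 1) * ε)| := by rw [pow_succ, mul_assoc]

lemma IsRich.exists_eventually_mul_le (hrich : IsRich M) (hM : M =Θ[𝓝[>] 0] E)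
    (hE : ∀ ε, 0 ≤ E ε) {B : ℝ} (hB : 0 ≤ B) :
    ∃ k : ℝ, 0 < k ∧ ∀ᶠ ε in 𝓝[>] 0, B * E ε ≤ E (k * ε) := by
  obtain ⟨α, r, hα, hr, hgrow⟩ := hrich.exists_eventually_mul_abs_le
  obtain ⟨a, ha, hMa⟩ := hM.1.exists_pos
  obtain ⟨c, hMc⟩ := hM.2.bound
  obtain ⟨j, hj⟩ := pow_unbounded_of_one_lt (B * c * a) hr
  refine ⟨α ^ j, by positivity, ?_⟩
  filter_upwards [eventually_pow_mul_abs_le hα (by linarith) (hgrow.mono fun _ h => h.2) j,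
    hMc, eventually_nhdsGT_zero_mul_left (pow_pos hα j) hMa.bound] with ε hpow hEM hME
  rw [Real.norm_eq_abs, Real.norm_eq_abs, abs_of_nonneg (hE _)] at hEM hME
  refine le_of_mul_le_mul_left ?_ ha
  calc a * (B * E ε) ≤ a * (B * (c * |M ε|)) := by gcongr
    _ = B * c * a * |M ε| := by ring
    _ ≤ r ^ j * |M ε| := by gcongr
    _ ≤ a * E (α ^ j * ε) := hpow.trans hME

lemma IsRich.exists_eventually_le (hrich : IsRich M) (hM : M =Θ[𝓝[>] 0] E)
    (hE : ∀ ε, 0 ≤ E ε) (hanti : AntitoneOn E (Set.Ioi 0)) :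
    ∃ m : ℝ, 0 < m ∧ ∀ᶠ ε in 𝓝[>] 0, m ≤ E ε := by
  obtain ⟨α, r, -, -, hgrow⟩ := hrich.exists_eventually_mul_abs_le
  obtain ⟨a, -, hMa⟩ := hM.1.exists_pos
  obtain ⟨δ, ⟨hne, -⟩, hδ, hδ₀⟩ := (hgrow.and (hMa.bound.and self_mem_nhdsWithin)).exists
  refine ⟨E δ, (hE δ).lt_of_ne' fun h₀ => hne ?_, ?_⟩
  · rwa [h₀, norm_zero, mul_zero, norm_le_zero_iff] at hδ
  · filter_upwards [Ioc_mem_nhdsGT hδ₀] with ε hε using hanti hε.1 hδ₀ hε.2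

lemma eventually_lt_natCast_mul_sq {δ : ℝ} (hδ : 0 < δ) (y : ℝ) :
    ∀ᶠ n : ℕ in atTop, y < n * δ ^ 2 :=
  (tendsto_natCast_atTop_atTop.atTop_mul_const (by positivity)).eventually_gt_atTop y

lemma tendsto_of_eventually_eq_mul_sq (hanti : AntitoneOn E (Set.Ioi 0)) {ε : ℕ → ℝ}
    (hε : ∀ᶠ n : ℕ in atTop, 0 < ε n ∧ E (ε n) = n * ε n ^ 2) :
    Tendsto ε atTop (𝓝[>] 0) := by
  refine tendsto_nhdsWithin_iff.2 ⟨tendsto_order.2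
    ⟨fun a ha => hε.mono fun n hn => ha.trans hn.1, fun δ hδ => ?_⟩, hε.mono fun n hn => hn.1⟩
  filter_upwards [hε, eventually_lt_natCast_mul_sq hδ (E δ)] with n ⟨hεn, heq⟩ hlt
  by_contra! hle
  refine hlt.not_ge ?_
  calc n * δ ^ 2 ≤ n * ε n ^ 2 := by gcongr
    _ = E (ε n) := heq.symm
    _ ≤ E δ := hanti hδ hεn hle

lemma criticalRadius_le {n : ℕ} {ε : ℝ} (hε : 0 < ε) (h : E ε ≤ n * ε ^ 2) :
    criticalRadius E n ≤ ε :=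
  csInf_le ⟨0, fun _ hδ => hδ.1.le⟩ ⟨hε, h⟩

lemma eventually_criticalRadius_pos (hpos : ∃ m : ℝ, 0 < m ∧ ∀ᶠ ε in 𝓝[>] 0, m ≤ E ε) :
    ∀ᶠ n in atTop, 0 < criticalRadius E n := by
  obtain ⟨m, hm, hmE⟩ := hpos
  obtain ⟨δ, hδ, hδE⟩ := mem_nhdsGT_iff_exists_Ioc_subset.1 hmE
  rw [Set.mem_Ioi] at hδ
  filter_upwards [eventually_lt_natCast_mul_sq hδ (E δ), eventually_gt_atTop 0] with n hlt hn
  have hn' : (0 : ℝ) < n := by exact_mod_cast hn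
  have hlow : 0 < min δ (Real.sqrt (m / n)) := by positivity
  refine hlow.trans_le (le_csInf ⟨δ, hδ, hlt.le⟩ fun ε hε => ?_)
  rcases le_or_gt ε δ with hεδ | hδε
  · refine (min_le_right _ _).trans (Real.sqrt_le_iff.2 ⟨hε.1.le, ?_⟩)
    rw [div_le_iff₀ hn', mul_comm]
    exact (hδE ⟨hε.1, hεδ⟩).trans hε.2
  · exact (min_le_left _ _).trans hδε.le

lemma tendsto_criticalRadius (hpos : ∃ m : ℝ, 0 < m ∧ ∀ᶠ ε in 𝓝[>] 0, m ≤ E ε) :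
    Tendsto (criticalRadius E) atTop (𝓝[>] 0) := by
  have hpos' := eventually_criticalRadius_pos hpos
  refine tendsto_nhdsWithin_iff.2 ⟨tendsto_order.2
    ⟨fun a ha => hpos'.mono fun n hn => ha.trans hn, fun δ hδ => ?_⟩, hpos'⟩
  filter_upwards [eventually_lt_natCast_mul_sq (half_pos hδ) (E (δ / 2))] with n hn
  exact (criticalRadius_le (half_pos hδ) hn.le).trans_lt (half_lt_self hδ)

lemma apply_two_mul_criticalRadius_le (hanti : AntitoneOn E (Set.Ioi 0)) {n : ℕ}
    (hr : 0 < criticalRadius E n) :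
    E (2 * criticalRadius E n) ≤ 4 * (n * criticalRadius E n ^ 2) := by
  have hne : {ε : ℝ | 0 < ε ∧ E ε ≤ n * ε ^ 2}.Nonempty := by
    refine Set.nonempty_iff_ne_empty.2 fun hempty => hr.ne' ?_
    rw [criticalRadius, hempty, Real.sInf_empty]
  obtain ⟨ε, ⟨hε, hEε⟩, hlt⟩ := exists_lt_of_csInf_lt hne (lt_two_mul_self hr)
  calc E (2 * criticalRadius E n) ≤ E ε := hanti hε (hε.trans hlt) hlt.le
    _ ≤ n * ε ^ 2 := hEε
    _ ≤ n * (2 * criticalRadius E n) ^ 2 := by gcongr; exact hlt.le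
    _ = 4 * (n * criticalRadius E n ^ 2) := by ring

lemma mul_criticalRadius_sq_le {n : ℕ} (hr : 0 < criticalRadius E n) :
    n * criticalRadius E n ^ 2 ≤ 4 * E (1 / 2 * criticalRadius E n) := by
  have hlt : n * (1 / 2 * criticalRadius E n) ^ 2 < E (1 / 2 * criticalRadius E n) := by
    by_contra! hle
    linarith [criticalRadius_le (by positivity) hle]
  linarith

end Entropy

section Rate

variable {R : ℕ → ℝ≥0∞} {E : ℝ → ℝ} {r : ℕ → ℝ} {a c A C : ℝ}

lemma exists_eventually_le_ofReal_sq
    (hup : ∃ K : ℝ, 0 < K ∧ ∀ (ε : ℝ) (n : ℕ), 0 < ε → 0 < n →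
      R n ≤ ENNReal.ofReal (K * ((E ε + 1) / n + ε ^ 2)))
    (hpos : ∃ m : ℝ, 0 < m ∧ ∀ᶠ ε in 𝓝[>] 0, m ≤ E ε) (hr : Tendsto r atTop (𝓝[>] 0))
    (ha : 0 < a) (hA : 0 < A) (hEA : ∀ᶠ n : ℕ in atTop, E (a * r n) ≤ A * (n * r n ^ 2)) :
    ∃ B : ℝ, 0 < B ∧ ∀ᶠ n in atTop, R n ≤ ENNReal.ofReal (B * r n ^ 2) := by
  obtain ⟨K, hK, hup⟩ := hup
  obtain ⟨m, hm, hmE⟩ := hpos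
  refine ⟨K * (A + A / m + a ^ 2), by positivity, ?_⟩
  filter_upwards [hEA, hr.eventually (eventually_nhdsGT_zero_mul_left ha hmE),
    hr.eventually self_mem_nhdsWithin, eventually_gt_atTop 0] with n hEn hmn (hrn : 0 < r n) hn
  have hn' : (0 : ℝ) < n := by exact_mod_cast hn
  refine (hup (a * r n) n (by positivity) hn).trans (ENNReal.ofReal_le_ofReal ?_)
  have hone : 1 ≤ A / m * (n * r n ^ 2) := by
    rw [div_mul_eq_mul_div, one_le_div hm]
    exact hmn.trans hEn
  have hentropy : (E (a * r n) + 1) / n ≤ (A + A / m) * r n ^ 2 := by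
    rw [div_le_iff₀ hn']
    linarith
  calc K * ((E (a * r n) + 1) / n + (a * r n) ^ 2)
      ≤ K * ((A + A / m) * r n ^ 2 + (a * r n) ^ 2) := by gcongr
    _ = K * (A + A / m + a ^ 2) * r n ^ 2 := by ring

lemma exists_eventually_ofReal_sq_le
    (hlow : ∃ K : ℝ, 0 ≤ K ∧ ∀ (ε δ : ℝ) (n : ℕ), 0 < ε → 0 < δ →
      Real.log 4 + E ε + K * (n * ε ^ 2) ≤ E δ → ENNReal.ofReal (δ ^ 2 / 8) ≤ R n)
    (hgrow : ∀ B : ℝ, 0 ≤ B → ∃ k : ℝ, 0 < k ∧ ∀ᶠ ε in 𝓝[>] 0, B * E ε ≤ E (k * ε))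
    (hpos : ∃ m : ℝ, 0 < m ∧ ∀ᶠ ε in 𝓝[>] 0, m ≤ E ε) (hr : Tendsto r atTop (𝓝[>] 0))
    (hc : 0 < c) (hC : 0 ≤ C) (hEC : ∀ᶠ n : ℕ in atTop, n * r n ^ 2 ≤ C * E (c * r n)) :
    ∃ b : ℝ, 0 < b ∧ ∀ᶠ n in atTop, ENNReal.ofReal (b * r n ^ 2) ≤ R n := by
  obtain ⟨K, hK, hlow⟩ := hlow
  obtain ⟨m, hm, hmE⟩ := hpos
  have : 0 ≤ Real.log 4 := Real.log_nonneg (by norm_num)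
  obtain ⟨k, hk, hkE⟩ := hgrow (Real.log 4 / m + 1 + K * c ^ 2 * C) (by positivity)
  refine ⟨(k * c) ^ 2 / 8, by positivity, ?_⟩
  filter_upwards [hEC, hr.eventually (eventually_nhdsGT_zero_mul_left hc (hmE.and hkE)),
    hr.eventually self_mem_nhdsWithin] with n hEn ⟨hmn, hkn⟩ (hrn : 0 < r n)
  have hgap : Real.log 4 + E (c * r n) + K * (n * (c * r n) ^ 2) ≤ E (k * (c * r n)) :=
    calc Real.log 4 + E (c * r n) + K * (n * (c * r n) ^ 2)
        = Real.log 4 * 1 + E (c * r n) + K * c ^ 2 * (n * r n ^ 2) := by ring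
      _ ≤ Real.log 4 * (E (c * r n) / m) + E (c * r n) + K * c ^ 2 * (C * E (c * r n)) := by
          gcongr
          exact (one_le_div hm).2 hmn
      _ = (Real.log 4 / m + 1 + K * c ^ 2 * C) * E (c * r n) := by ring
      _ ≤ E (k * (c * r n)) := hkn
  refine le_of_eq_of_le ?_ (hlow (c * r n) (k * (c * r n)) n (by positivity) (by positivity) hgap)
  ring_nf

lemma sameOrder_sq_of_bracket
    (hup : ∃ K : ℝ, 0 < K ∧ ∀ (ε : ℝ) (n : ℕ), 0 < ε → 0 < n →
      R n ≤ ENNReal.ofReal (K * ((E ε + 1) / n + ε ^ 2)))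
    (hlow : ∃ K : ℝ, 0 ≤ K ∧ ∀ (ε δ : ℝ) (n : ℕ), 0 < ε → 0 < δ →
      Real.log 4 + E ε + K * (n * ε ^ 2) ≤ E δ → ENNReal.ofReal (δ ^ 2 / 8) ≤ R n)
    (hgrow : ∀ B : ℝ, 0 ≤ B → ∃ k : ℝ, 0 < k ∧ ∀ᶠ ε in 𝓝[>] 0, B * E ε ≤ E (k * ε))
    (hpos : ∃ m : ℝ, 0 < m ∧ ∀ᶠ ε in 𝓝[>] 0, m ≤ E ε) (hr : Tendsto r atTop (𝓝[>] 0))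
    (ha : 0 < a) (hA : 0 < A) (hEA : ∀ᶠ n : ℕ in atTop, E (a * r n) ≤ A * (n * r n ^ 2))
    (hc : 0 < c) (hC : 0 ≤ C) (hEC : ∀ᶠ n : ℕ in atTop, n * r n ^ 2 ≤ C * E (c * r n)) :
    SameOrder R fun n => r n ^ 2 := by
  obtain ⟨b, hb, hbR⟩ := exists_eventually_ofReal_sq_le hlow hgrow hpos hr hc hC hEC
  obtain ⟨B, hB, hBR⟩ := exists_eventually_le_ofReal_sq hup hpos hr ha hA hEA
  exact ⟨b, B, hb, hB, hbR.and hBR⟩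

lemma sameOrder_sq_of_isTheta
    (hup : ∃ K : ℝ, 0 < K ∧ ∀ (ε : ℝ) (n : ℕ), 0 < ε → 0 < n →
      R n ≤ ENNReal.ofReal (K * ((E ε + 1) / n + ε ^ 2)))
    (hlow : ∃ K : ℝ, 0 ≤ K ∧ ∀ (ε δ : ℝ) (n : ℕ), 0 < ε → 0 < δ →
      Real.log 4 + E ε + K * (n * ε ^ 2) ≤ E δ → ENNReal.ofReal (δ ^ 2 / 8) ≤ R n)
    (hgrow : ∀ B : ℝ, 0 ≤ B → ∃ k : ℝ, 0 < k ∧ ∀ᶠ ε in 𝓝[>] 0, B * E ε ≤ E (k * ε))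
    (hpos : ∃ m : ℝ, 0 < m ∧ ∀ᶠ ε in 𝓝[>] 0, m ≤ E ε) (hr : Tendsto r atTop (𝓝[>] 0))
    (hE : ∀ ε, 0 ≤ E ε) (hΘ : (fun n => E (r n)) =Θ[atTop] fun n : ℕ => (n : ℝ) * r n ^ 2) :
    SameOrder R fun n => r n ^ 2 := by
  obtain ⟨A, hA, hEA⟩ := hΘ.1.exists_pos
  obtain ⟨C, hC, hEC⟩ := hΘ.2.exists_pos
  refine sameOrder_sq_of_bracket hup hlow hgrow hpos hr one_pos hA (hEA.bound.mono fun n hn => ?_)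
    one_pos hC.le (hEC.bound.mono fun n hn => ?_) <;>
  rwa [one_mul, ← Real.norm_of_nonneg (hE (r n)),
    ← Real.norm_of_nonneg (show (0 : ℝ) ≤ n * r n ^ 2 by positivity)]

end Rate

end ExpectileMinimax

theorem corollary2_general {X : Type*} [MeasurableSpace X] (ν : Measure X)
    (φ s : ℝ) (hφ₀ : 0 < φ) (hφ₁ : φ < 1) (hs : 0 < s)
    (U : Set (X → ℝ)) (hUmeas : ∀ μ ∈ U, Measurable μ)
    (hUbdd : ∃ J : ℝ, ∀ μ ∈ U, ∀ x, |μ x| ≤ J)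
    (S : Set (X → ℝ)) (hSmeas : ∀ σ ∈ S, Measurable σ) (hSpos : ∀ σ ∈ S, ∀ x, 0 < σ x)
    (hSle : ∃ b : ℝ, ∀ σ ∈ S, ∀ x, σ x ≤ b) (hSge : ∃ σ ∈ S, ∃ τ : ℝ, 0 < τ ∧ ∀ x, τ ≤ σ x)
    (H : Set (X → ℝ)) (hH : ∀ h ∈ H, IsDensity ν h)
    (h₀ : X → ℝ) (hh₀ : h₀ ∈ H) (hdom : ∃ C : ℝ, ∀ h ∈ H, ∀ᵐ x ∂ν, h x ≤ C * h₀ x)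
    (hUtb : IsTotallyBounded ν h₀ U)
    (M : ℝ → ℝ) (hM : M =Θ[𝓝[>] 0] packingEntropy ν h₀ U) (hrich : IsRich M) :
    (∀ μ ∈ U, ∀ σ ∈ S, ∀ x z, IsExpectile φ (responseLaw φ s μ σ x) z ↔ z = μ x) ∧
    (∀ ε : ℕ → ℝ,
      (∀ᶠ n : ℕ in atTop, 0 < ε n ∧ packingEntropy ν h₀ U (ε n) = n * ε n ^ 2) →
      SameOrder (minimaxRisk ν φ s U S H) fun n => ε n ^ 2) ∧
    SameOrder (minimaxRisk ν φ s U S H)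
      (fun n => criticalRadius (packingEntropy ν h₀ U) n ^ 2) ∧
    (∀ ε : ℕ → ℝ, Tendsto ε atTop (𝓝[>] 0) →
      ((fun n : ℕ => M (ε n)) =Θ[atTop] fun n : ℕ => (n : ℝ) * ε n ^ 2) →
      SameOrder (minimaxRisk ν φ s U S H) fun n => ε n ^ 2) := by
  obtain ⟨J, hUJ⟩ := hUbdd
  obtain ⟨b, hSb⟩ := hSle
  obtain ⟨C, hC⟩ := hdom
  have hdom (h : X → ℝ) (hh : h ∈ H) : ∀ᵐ x ∂ν, h x ≤ max C 0 * h₀ x := (hC h hh).mono fun x hx =>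
    hx.trans (mul_le_mul_of_nonneg_right (le_max_left C 0) ((hH h₀ hh₀).nonneg x))
  obtain ⟨σ, hσ, τ, hτ, hστ⟩ := hSge
  have hanti := packingEntropy_antitoneOn hUtb
  have hpos := hrich.exists_eventually_le hM packingEntropy_nonneg hanti
  have upper := exists_minimaxRisk_le hφ₀ hφ₁ hs hUmeas hUJ hSmeas
    (fun σ hσ x => (hSpos σ hσ x).le) hSb hH (hH h₀ hh₀).measurable (le_max_right C 0) hdom hUtb
  have lower := exists_le_minimaxRisk hφ₀ hφ₁ hs hUmeas hUJ hσ (hSmeas σ hσ) hτ hστ hh₀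
    (hH h₀ hh₀) hUtb
  have growth (B : ℝ) (hB : 0 ≤ B) := hrich.exists_eventually_mul_le hM packingEntropy_nonneg hB
  have rate (ε : ℕ → ℝ) (hε : Tendsto ε atTop (𝓝[>] 0)) :=
    sameOrder_sq_of_isTheta upper lower growth hpos hε packingEntropy_nonneg
  refine ⟨fun μ _ σ hσ x z => isExpectile_responseLaw_iff hφ₀ hφ₁ hs μ (hSpos σ hσ x).le,
    fun ε hε => ?_, ?_, fun ε hε hΘ => ?_⟩
  · exact rate ε (tendsto_of_eventually_eq_mul_sq hanti hε)
      (EventuallyEq.isTheta (hε.mono fun n hn => hn.2))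
  · have hr := eventually_criticalRadius_pos hpos
    exact sameOrder_sq_of_bracket upper lower growth hpos (tendsto_criticalRadius hpos) two_pos
      four_pos (hr.mono fun n => apply_two_mul_criticalRadius_le hanti) one_half_pos zero_le_four
      (hr.mono fun n => mul_criticalRadius_sq_le)
  · have hME : (fun n => M (ε n)) =Θ[atTop] fun n => packingEntropy ν h₀ U (ε n) :=
      ⟨hM.1.comp_tendsto hε, hM.2.comp_tendsto hε⟩
    exact rate ε hε (hME.symm.trans hΘ)

theorem corollary2 {X : Type*} [MeasurableSpace X] (ν : Measure X) [SigmaFinite ν]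
    -- the asymmetric normal error with location 0, skewness φ and scale s
    (φ s : ℝ) (hφ₀ : 0 < φ) (hφ₁ : φ < 1) (hs : 0 < s)
    -- the regression functions
    (U : Set (X → ℝ)) (hUmeas : ∀ μ ∈ U, Measurable μ)
    (hUbdd : ∃ J : ℝ, ∀ μ ∈ U, ∀ x, |μ x| ≤ J)
    -- the scale functions
    (S : Set (X → ℝ)) (hSne : S.Nonempty) (hSmeas : ∀ σ ∈ S, Measurable σ)
    (hSbdd : ∃ b : ℝ, 1 < b ∧ ∀ σ ∈ S, ∀ x, b⁻¹ ≤ σ x ∧ σ x ≤ b)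
    -- the covariate densities, with a dominating member
    (H : Set (X → ℝ)) (hH : ∀ h ∈ H, IsDensity ν h)
    (h₀ : X → ℝ) (hh₀ : h₀ ∈ H) (hdom : ∃ C : ℝ, ∀ h ∈ H, ∀ᵐ x ∂ν, h x ≤ C * h₀ x)
    -- the entropy conditions
    (hUtb : IsTotallyBounded ν h₀ U) (hStb : IsTotallyBounded ν h₀ S)
    (M : ℝ → ℝ) (hM : M =Θ[𝓝[>] 0] packingEntropy ν h₀ U)
    (hrich : IsRich M) (hreg : IsOrderRegular M)
    (hSU : packingEntropy ν h₀ S =O[𝓝[>] 0] packingEntropy ν h₀ U) :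
    -- the regression function is the conditional expectile of the response
    (∀ μ ∈ U, ∀ σ ∈ S, ∀ x z, IsExpectile φ (responseLaw φ s μ σ x) z ↔ z = μ x) ∧
    -- the rate, with the radius solving the equation for the packing entropy itself
    (∀ ε : ℕ → ℝ,
      (∀ᶠ n : ℕ in atTop, 0 < ε n ∧ packingEntropy ν h₀ U (ε n) = n * ε n ^ 2) →
      SameOrder (minimaxRisk ν φ s U S H) fun n => ε n ^ 2) ∧
    -- the rate, with the crossing point when the packing entropy jumps over the equation
    SameOrder (minimaxRisk ν φ s U S H)
      (fun n => criticalRadius (packingEntropy ν h₀ U) n ^ 2) ∧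
    -- the rate, with the radius solving the equation (in order) for the known entropy order
    (∀ ε : ℕ → ℝ, Tendsto ε atTop (𝓝[>] 0) →
      ((fun n : ℕ => M (ε n)) =Θ[atTop] fun n : ℕ => (n : ℝ) * ε n ^ 2) →
      SameOrder (minimaxRisk ν φ s U S H) fun n => ε n ^ 2) := by
  obtain ⟨b, hb, hSb⟩ := hSbdd
  obtain ⟨σ, hσ⟩ := hSne
  have hb₀ : 0 < b⁻¹ := inv_pos.2 (one_pos.trans hb)
  exact corollary2_general ν φ s hφ₀ hφ₁ hs U hUmeas hUbdd S hSmeas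
    (fun σ hσ x => hb₀.trans_le (hSb σ hσ x).1) ⟨b, fun σ hσ x => (hSb σ hσ x).2⟩
    ⟨σ, hσ, b⁻¹, hb₀, fun x => (hSb σ hσ x).1⟩ H hH h₀ hh₀ hdom hUtb M hM hrich
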